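/- **Setting.** Consider an $N$-player general-sum polyhedral game. Player $i$ has a nonempty polytope $\mathcal X_i=\operatorname{conv}(\mathcal A_i)\subset\mathbb R^{n_i}$ with finite vertex set $\mathcal A_i$ (the pure strategies) and a utility $u_i$ that is multilinear in the strategies $(x_1,\dots,x_N)$. Norms are Euclidean. Write $\ell_i(x)=-\nabla_{x_i}u_i(x)$ and assume the normalizations $\|\ell_i(x)\|\le 1$ and $\|\ell_i(x)-\ell_i(y)\|\le\sum_{j\ne i}\|x_j-y_j\|$ for all $x,y\in\prod_j\mathcal X_j$. Player $i$ has a $1$-strongly convex regularizer $\varphi_i$ on $\mathcal X_i$ with $L_i$-Lipschitz gradient. Let $\mathcal D_i(x\|y)=\varphi_i(x)-\varphi_i(y)-\langle\nabla\varphi_i(y),x-y\rangle$, $\Omega_i=\sup_{x,y\in\mathcal X_i}\mathcal D_i(x\|y)$, $D_i=\operatorname{diam}\mathcal X_i$, and let $\delta_i=\min_F\operatorname{dist}(F,\operatorname{conv}(\mathcal A_i\setminus F))$ be the facial distance, with $F$ ranging over the nonempty proper faces of $\mathcal X_i$. **Algorithm 1 (approximate reflected online mirror descent).** Start at any $x_i^0\in\mathcal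 X_i$. Let $\ell_i^0=m_i^0=0$, $\ell_i^t=\ell_i(x^t)$ and $m_i^t=\ell_i^{t-1}$ for $t\ge1$. In round $t=1,\dots,T$ every player $i$ chooses $x_i^t\in\mathcal X_i$ that minimizes $$F_i^t(z)=\eta\langle \ell_i^{t-1}+m_i^t-m_i^{t-1},z\rangle+\mathcal D_i(z\|x_i^{t-1})$$ over $\mathcal X_i$ up to an additive error $\varepsilon_i^t$; any such point is allowed. The step size is $\eta=T^{-1/4}$. The regret is $\mathrm{Reg}_i^T=\max_{x'\in\mathcal X_i}\sum_{t=1}^T\langle\ell_i^t,x_i^t-x'\rangle$. **AFW-ROMD** computes $x_i^t$ by away-step Frank–Wolfe applied to $F_i^t$, started at an arbitrary vertex, with an arbitrary linear minimization oracle (LMO) over $\mathcal A_i$, one LMO call per iteration, the step sizes $\min\{\langle-\nabla F_i^t,d\rangle/(L_i\|d\|^2),\gamma_{\max}\}$, and stopped at the first iterate whose Frank–Wolfe (Wolfe) gap is at most $\varepsilon_i^t$. **CCE.** A distribution $\mu$ on $\prod_i\mathcal A_i$ is an $\varepsilon'$-CCE if $\mathbb E_{a\sim\mu}u_i(a)\ge\mathbb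 E_{a\sim\mu}u_i(a_i',a_{-i})-\varepsilon'$ for all $i$ and $a_i'\in\mathcal A_i$. The average joint strategy of the first $T$ rounds is $\frac1T\sum_{t=1}^T\bigotimes_i w_i^t$, where $w_i^t$ is any distribution on $\mathcal A_i$ with mean $x_i^t$. **Theorem.** For every $N$ and $\omega$ there are constants $C_1,C_2,C_3>0$ such that for every such game and all such regularizers with $\Omega_i\le\omega$ for all $i$ there are $T_0\in\mathbb N$ and $\varepsilon_0>0$ (depending on the game and the regularizers) with the following properties. 1. *Algorithm 1.* Run it for $T$ rounds with $0\le\varepsilon_i^t\le\eta/t^2$ (that is, $F_i^t/\eta$ is minimized up to an error of at most $1/t^2$). Then $\mathrm{Reg}_i^T\le C_1T^{1/4}$ for every $i$ if $T\ge T_0$; and if $0<\varepsilon'\le\varepsilon_0$ and $T\ge C_2\,\varepsilon'^{-4/3}$, the average joint strategy is an $\varepsilon'$-CCE. 2. *AFW-ROMD.* Run it for $T$ rounds with $\eta/t^2\le\varepsilon_i^t\le1/t^2$ (in particular with $\varepsilon_i^t=1/t^2$). Then every away-step Frank–Wolfe call terminates; $\mathrm{Reg}_i^T\le C_1T^{1/4}$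 for every $i$ and every $T$; and if $\varepsilon'>0$ and $T\ge C_2\,\varepsilon'^{-4/3}$, the average joint strategy is an $\varepsilon'$-CCE. If moreover every $\mathcal X_i$ has at least two points, $0<\varepsilon'\le\varepsilon_0$ and $T=\lceil C_2\,\varepsilon'^{-4/3}\rceil$, then the total number of LMO calls of all players in the $T$ rounds is at most $$C_3\,\max_{i\in[N]}\ \varepsilon'^{-4/3}\,\frac{L_iD_i^2}{\delta_i^2}\,\log\frac{L_iD_i}{\varepsilon'} .$$ -/

import Mathlib

open scoped BigOperators

namespace PolyGame

/-- Euclidean space `ℝ^d`. -/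
abbrev Vec (d : ℕ) : Type := EuclideanSpace ℝ (Fin d)

/-! ### Polytopes -/

/-- Distance between two sets: `inf { ‖x - y‖ : x ∈ s, y ∈ t }`. -/
noncomputable def setDist {d : ℕ} (s t : Set (Vec d)) : ℝ :=
  sInf {r : ℝ | ∃ x ∈ s, ∃ y ∈ t, r = dist x y}

/-- Facial distance of the polytope `P = conv V` with vertex set `V`: the minimum, over the nonempty
proper faces `F` of `P`, of the distance between `F` and the convex hull of the vertices of `P` that
are not in `F`. -/
noncomputable def facialDistance {d : ℕ} (V : Finset (Vec d)) : ℝ :=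
  sInf {r : ℝ | ∃ F : Set (Vec d), IsExposed ℝ (convexHull ℝ (V : Set (Vec d))) F ∧ F.Nonempty ∧
    F ≠ convexHull ℝ (V : Set (Vec d)) ∧
    r = setDist F (convexHull ℝ ((V : Set (Vec d)) \ F))}

/-! ### Regularizers, Bregman divergences, approximate proximal oracles -/

/-- A differentiable regularizer on `X` that is `1`-strongly convex and `L`-smooth (its gradient is
`L`-Lipschitz on `X`) for the Euclidean norm. Only its behaviour on `X` matters, so `grad x` is a
gradient of `toFun` relative to `X`. -/
structure Regularizer {d : ℕ} (X : Set (Vec d)) where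
  toFun : Vec d → ℝ
  grad : Vec d → Vec d
  L : ℝ
  strongConvex : StrongConvexOn X 1 toFun
  hasGradient : ∀ x ∈ X, HasGradientWithinAt toFun (grad x) X x
  smooth : ∀ x ∈ X, ∀ y ∈ X, ‖grad x - grad y‖ ≤ L * ‖x - y‖

/-- Bregman divergence `D(x ‖ y) = φ(x) - φ(y) - ⟨∇φ(y), x - y⟩`. -/
noncomputable def Regularizer.breg {d : ℕ} {X : Set (Vec d)} (R : Regularizer X) (x y : Vec d) : ℝ :=
  R.toFun x - R.toFun y - inner ℝ (R.grad y) (x - y)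

/-- `Ω = sup_{x, y ∈ X} D(x ‖ y)`. -/
noncomputable def Regularizer.omega {d : ℕ} {X : Set (Vec d)} (R : Regularizer X) : ℝ :=
  sSup {r : ℝ | ∃ x ∈ X, ∃ y ∈ X, r = R.breg x y}

/-- `x'` is an admissible answer of an approximate proximal oracle for the function `f`, the
regularizer `R`, the prox center `c` and the accuracy `ε`:
`f(x') + D(x' ‖ c) ≤ min_{x ∈ X} (f(x) + D(x ‖ c)) + ε`. -/
def IsAPO {d : ℕ} {X : Set (Vec d)} (R : Regularizer X) (f : Vec d → ℝ) (c : Vec d) (ε : ℝ)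
    (x' : Vec d) : Prop :=
  x' ∈ X ∧ ∀ x ∈ X, f x' + R.breg x' c ≤ f x + R.breg x c + ε

/-! ### Away-step Frank-Wolfe -/

/-- `lmo` is a linear minimization oracle over the finite set of atoms `V`. -/
def IsLMO {d : ℕ} (V : Finset (Vec d)) (lmo : Vec d → Vec d) : Prop :=
  ∀ g, lmo g ∈ V ∧ ∀ v ∈ V, inner ℝ g (lmo g) ≤ inner ℝ g v

/-- `away S g` is an element of the active set `S` that maximizes `⟨g, ·⟩`. -/
def IsAwayOracle {d : ℕ} (away : Finset (Vec d) → Vec d → Vec d) : Prop :=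
  ∀ (S : Finset (Vec d)) (g : Vec d), S.Nonempty →
    away S g ∈ S ∧ ∀ v ∈ S, inner ℝ g v ≤ inner ℝ g (away S g)

/-- State of away-step Frank-Wolfe: the iterate, the active set of atoms, and their weights. -/
structure AFWState (d : ℕ) where
  pt : Vec d
  active : Finset (Vec d)
  weight : Vec d → ℝ

open Classical in
/-- Initial state: the single atom `v₀` with weight `1`. -/
noncomputable def afwInit {d : ℕ} (v₀ : Vec d) : AFWState d where
  pt := v₀
  active := {v₀}
  weight := fun v => if v = v₀ then 1 else 0

/-- Frank-Wolfe (Wolfe) gap `⟨-∇f(x), s - x⟩`, where `s` is the answer of the LMO at `∇f(x)`. -/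
noncomputable def wolfeGap {d : ℕ} (lmo : Vec d → Vec d) (gradf : Vec d → Vec d) (x : Vec d) : ℝ :=
  inner ℝ (-gradf x) (lmo (gradf x) - x)

open Classical in
/-- One iteration of away-step Frank-Wolfe (one LMO call) on an `L`-smooth function with gradient
`gradf`. The weight of an atom outside the active set is `0`. -/
noncomputable def afwStep {d : ℕ} (lmo : Vec d → Vec d) (away : Finset (Vec d) → Vec d → Vec d)
    (gradf : Vec d → Vec d) (L : ℝ) (σ : AFWState d) : AFWState d :=
  let g := gradf σ.pt
  let s := lmo g
  let a := away σ.active g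
  let dFW := s - σ.pt
  let dA := σ.pt - a
  if inner ℝ (-g) dFW ≥ inner ℝ (-g) dA then
    let γ := min (inner ℝ (-g) dFW / (L * ‖dFW‖ ^ 2)) 1
    { pt := σ.pt + γ • dFW
      active := if γ = 1 then {s} else insert s σ.active
      weight := fun v => (1 - γ) * σ.weight v + if v = s then γ else 0 }
  else
    let γmax := σ.weight a / (1 - σ.weight a)
    let γ := min (inner ℝ (-g) dA / (L * ‖dA‖ ^ 2)) γmax
    { pt := σ.pt + γ • dA
      active := if γ = γmax then σ.active.erase a else σ.active
      weight := fun v => (1 + γ) * σ.weight v - if v = a then γ else 0 }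

/-- State after `k` iterations, started at the atom `v₀`. -/
noncomputable def afwState {d : ℕ} (lmo : Vec d → Vec d) (away : Finset (Vec d) → Vec d → Vec d)
    (gradf : Vec d → Vec d) (L : ℝ) (v₀ : Vec d) (k : ℕ) : AFWState d :=
  (afwStep lmo away gradf L)^[k] (afwInit v₀)

/-- The run reaches an iterate whose Wolfe gap is at most `ε`. -/
def AFWHalts {d : ℕ} (lmo : Vec d → Vec d) (away : Finset (Vec d) → Vec d → Vec d)
    (gradf : Vec d → Vec d) (L : ℝ) (v₀ : Vec d) (ε : ℝ) : Prop :=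
  ∃ k, wolfeGap lmo gradf (afwState lmo away gradf L v₀ k).pt ≤ ε

/-- Index of the first iterate whose Wolfe gap is at most `ε`. -/
noncomputable def afwStop {d : ℕ} (lmo : Vec d → Vec d) (away : Finset (Vec d) → Vec d → Vec d)
    (gradf : Vec d → Vec d) (L : ℝ) (v₀ : Vec d) (ε : ℝ) : ℕ :=
  sInf {k | wolfeGap lmo gradf (afwState lmo away gradf L v₀ k).pt ≤ ε}

/-- The point returned by away-step Frank-Wolfe. -/
noncomputable def afwOutput {d : ℕ} (lmo : Vec d → Vec d) (away : Finset (Vec d) → Vec d → Vec d)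
    (gradf : Vec d → Vec d) (L : ℝ) (v₀ : Vec d) (ε : ℝ) : Vec d :=
  (afwState lmo away gradf L v₀ (afwStop lmo away gradf L v₀ ε)).pt

/-- The number of LMO calls used: one per iteration, including the one at which the stopping test
succeeds. -/
noncomputable def afwCalls {d : ℕ} (lmo : Vec d → Vec d) (away : Finset (Vec d) → Vec d → Vec d)
    (gradf : Vec d → Vec d) (L : ℝ) (v₀ : Vec d) (ε : ℝ) : ℕ :=
  afwStop lmo away gradf L v₀ ε + 1

/-! ### Polyhedral games -/

/-- An `N`-player general-sum polyhedral game: player `i` has a nonempty polytope in `ℝ^(n i)`, given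
by its finite set `V i` of vertices (the pure strategies), and a utility that is multilinear in the
strategies of the players. -/
structure Game (N : ℕ) where
  n : Fin N → ℕ
  V : ∀ i, Finset (Vec (n i))
  nonempty : ∀ i, (V i).Nonempty
  vertices : ∀ i, (convexHull ℝ (V i : Set (Vec (n i)))).extremePoints ℝ = (V i : Set (Vec (n i)))
  u : Fin N → MultilinearMap ℝ (fun i => Vec (n i)) ℝ

namespace Game

variable {N : ℕ} (G : Game N)

/-- Strategy polytope of player `i`. -/
def X (i : Fin N) : Set (Vec (G.n i)) := convexHull ℝ (G.V i : Set (Vec (G.n i)))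

/-- Joint strategies (ambient space). -/
abbrev Profile : Type := ∀ i, Vec (G.n i)

/-- Loss vector of player `i` at a joint strategy: `-∇_{x_i} u_i(x_1, …, x_N)`. -/
noncomputable def loss (i : Fin N) (x : G.Profile) : Vec (G.n i) :=
  -gradient (fun y => G.u i (Function.update x i y)) (x i)

/-- Normalization of the game: the losses have norm at most `1`, and they satisfy the smoothness
condition `‖ℓ_i(x) - ℓ_i(y)‖ ≤ ∑_{j ≠ i} ‖x_j - y_j‖`. -/
structure Normalized : Prop where
  loss_le_one : ∀ i, ∀ x : G.Profile, (∀ j, x j ∈ G.X j) → ‖G.loss i x‖ ≤ 1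
  loss_smooth : ∀ i, ∀ x y : G.Profile, (∀ j, x j ∈ G.X j) → (∀ j, y j ∈ G.X j) →
    ‖G.loss i x - G.loss i y‖ ≤ ∑ j ∈ Finset.univ.erase i, ‖x j - y j‖

/-- Loss received in round `t` of self-play; `ℓ^0 = 0`. -/
noncomputable def lossAt (x : ℕ → G.Profile) (i : Fin N) (t : ℕ) : Vec (G.n i) :=
  if t = 0 then 0 else G.loss i (x t)

/-- Prediction for round `t`: the last observed loss, `m^t = ℓ^(t-1)`; `m^0 = 0`. -/
noncomputable def predAt (x : ℕ → G.Profile) (i : Fin N) (t : ℕ) : Vec (G.n i) :=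
  if t = 0 then 0 else G.lossAt x i (t - 1)

/-- The vector `ℓ^(t-1) + m^t - m^(t-1)` used in the update of round `t ≥ 1`. -/
noncomputable def stepVec (x : ℕ → G.Profile) (i : Fin N) (t : ℕ) : Vec (G.n i) :=
  G.lossAt x i (t - 1) + G.predAt x i t - G.predAt x i (t - 1)

/-- Regret of player `i` after `T` rounds: `max_{x' ∈ X_i} ∑_{t=1}^T (⟨ℓ^t, x^t⟩ - ⟨ℓ^t, x'⟩)`. -/
noncomputable def regret (x : ℕ → G.Profile) (i : Fin N) (T : ℕ) : ℝ :=
  sSup ((fun x' => ∑ t ∈ Finset.Icc 1 T,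
    (inner ℝ (G.lossAt x i t) (x t i) - inner ℝ (G.lossAt x i t) x')) '' G.X i)

/-- `T` rounds of self-play in which every player uses reflected online mirror descent with
approximate proximal computation (step size `η`, accuracy `ε i t` for player `i` in round `t`, last
observed loss as prediction), with arbitrary answers of the approximate proximal oracles. -/
def IsROMDRun (R : ∀ i, Regularizer (G.X i)) (η : ℝ) (ε : Fin N → ℕ → ℝ) (T : ℕ)
    (x : ℕ → G.Profile) : Prop :=
  (∀ i, x 0 i ∈ G.X i) ∧
  ∀ t ∈ Finset.Icc 1 T, ∀ i,
    IsAPO (R i) (fun z => η * inner ℝ (G.stepVec x i t) z) (x (t - 1) i) (ε i t) (x t i)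

/-- Gradient of the proximal objective `z ↦ η ⟨ℓ^(t-1) + m^t - m^(t-1), z⟩ + D(z ‖ x^(t-1))`. -/
noncomputable def proxGrad (R : ∀ i, Regularizer (G.X i)) (η : ℝ) (x : ℕ → G.Profile) (i : Fin N)
    (t : ℕ) (z : Vec (G.n i)) : Vec (G.n i) :=
  η • G.stepVec x i t + (R i).grad z - (R i).grad (x (t - 1) i)

/-- The choices left open by AFW-ROMD: LMOs and away-vertex selections (tie breaking), and for each
round the vertex at which away-step Frank-Wolfe is started. -/
structure Oracles where
  lmo : ∀ i, Vec (G.n i) → Vec (G.n i)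
  away : ∀ i, Finset (Vec (G.n i)) → Vec (G.n i) → Vec (G.n i)
  start : ∀ i, ℕ → Vec (G.n i)
  isLMO : ∀ i, IsLMO (G.V i) (lmo i)
  isAway : ∀ i, IsAwayOracle (away i)
  start_mem : ∀ i t, start i t ∈ G.V i

/-- `T` rounds of self-play in which every player uses AFW-ROMD: the update is computed by away-step
Frank-Wolfe with tolerance `ε i t` on the Wolfe gap of the proximal objective. -/
def IsAFWRun (R : ∀ i, Regularizer (G.X i)) (η : ℝ) (ε : Fin N → ℕ → ℝ) (O : G.Oracles) (T : ℕ)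
    (x : ℕ → G.Profile) : Prop :=
  (∀ i, x 0 i ∈ G.X i) ∧
  ∀ t ∈ Finset.Icc 1 T, ∀ i,
    x t i = afwOutput (O.lmo i) (O.away i) (G.proxGrad R η x i t) (R i).L (O.start i t) (ε i t)

/-- Number of LMO calls made by player `i` in round `t`. -/
noncomputable def callsAt (R : ∀ i, Regularizer (G.X i)) (η : ℝ) (ε : Fin N → ℕ → ℝ)
    (O : G.Oracles) (x : ℕ → G.Profile) (i : Fin N) (t : ℕ) : ℕ :=
  afwCalls (O.lmo i) (O.away i) (G.proxGrad R η x i t) (R i).L (O.start i t) (ε i t)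

/-- The away-step Frank-Wolfe call of player `i` in round `t` terminates. -/
def HaltsAt (R : ∀ i, Regularizer (G.X i)) (η : ℝ) (ε : Fin N → ℕ → ℝ)
    (O : G.Oracles) (x : ℕ → G.Profile) (i : Fin N) (t : ℕ) : Prop :=
  AFWHalts (O.lmo i) (O.away i) (G.proxGrad R η x i t) (R i).L (O.start i t) (ε i t)

/-- Pure joint strategies `∏_i A_i`. -/
abbrev PureProfile : Type := ∀ i, G.V i

/-- `μ ∈ Δ(∏_i A_i)` is an `ε`-coarse correlated equilibrium:
`E_{a ∼ μ} u_i(a) ≥ E_{a ∼ μ} u_i(a'_i, a_{-i}) - ε` for all `i` and all `a'_i ∈ A_i`. -/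
def IsCCE (μ : G.PureProfile → ℝ) (ε : ℝ) : Prop :=
  μ ∈ stdSimplex ℝ G.PureProfile ∧
  ∀ i, ∀ a' : G.V i,
    ∑ a : G.PureProfile, μ a * G.u i (fun j => (a j : Vec (G.n j))) ≥
      ∑ a : G.PureProfile,
        μ a * G.u i (Function.update (fun j => (a j : Vec (G.n j))) i (a' : Vec (G.n i))) - ε

/-- `w t i` is a probability distribution on the vertices of player `i` with mean `x t i`, for all
players and all rounds `1, …, T`. -/
def Represents (T : ℕ) (x : ℕ → G.Profile) (w : ℕ → ∀ i, G.V i → ℝ) : Prop :=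
  ∀ t ∈ Finset.Icc 1 T, ∀ i, w t i ∈ stdSimplex ℝ (G.V i) ∧
    ∑ v : G.V i, w t i v • (v : Vec (G.n i)) = x t i

/-- Average joint strategy `(1/T) ∑_{t=1}^T ⨂_i w_i^t`. -/
noncomputable def avgJoint (T : ℕ) (w : ℕ → ∀ i, G.V i → ℝ) (a : G.PureProfile) : ℝ :=
  (1 / (T : ℝ)) * ∑ t ∈ Finset.Icc 1 T, ∏ i, w t i (a i)

end Game

end PolyGame

/-! Everything is driven by one quantity: a bound `g i t` on the Frank-Wolfe gap of the proximal
objective at the point chosen by player `i` in round `t` (`IsGapRun`).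

Regret. With `e t = ℓ t - m t`, the vector used in the update is `ℓ t - (e t - e (t - 1))`, so the
corrections can be summed by parts, leaving a boundary term and the products `⟨e t, x (t + 1) - x
t⟩`. The three-point identity supplies `-½‖x (t + 1) - x t‖²`, which absorbs these products up to
`η²/2 ‖e t‖²` (`sum_inner_le_of_gap`). All players move slowly, `‖x t - x (t - 1)‖² ≤ 2 g + 9 η²`,
so smoothness of the losses bounds `∑ ‖e t‖²` by `1` plus multiples of the total gap and of `N² η²
T`. For `η = T^(-1/4)` and gaps of sum at most `2` per player, `η * regret` is bounded in terms of
`N` and `ω` alone (`IsGapRun.regret_le`). Multilinearity turns regret at most `T ε'` into an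
`ε'`-CCE (`isCCE_avgJoint`).

Gaps. Away-step Frank-Wolfe stops on the gap itself, and `∑ 1/t² ≤ 2` for every `T`. An arbitrary
`ε`-minimizer only has gap at most `ε/γ + γ|L|D²/2` for each `γ ∈ (0, 1]` (`gap_le_of_isAPO`); with
`γ = √η/t` the sum is of order `√η log T`. It tends to `0` at a speed depending on the game, whence
`T₀`.

LMO calls. A least-mass transport between convex representations (`exists_transport`) yields `δ ⟨g,
x - y⟩ ≤ ‖x - y‖ G` for the pairwise gap `G`. Strong convexity gives primal gap at most `G²/(2δ²)`,
so each step that drops no atom contracts it by `1 - δ²/(4LD²)`, and at most half of the steps are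
drops (`afwState_progress`). The tolerances are polynomial in `ε'`, so the logarithm is of order
`log (1/ε')`. -/

namespace PolyGame

/-! ### Bregman divergences of strongly convex, smooth regularizers. -/

section Regularizers

variable {d : ℕ} {X : Set (Vec d)}

namespace Regularizer

lemma convex (R : Regularizer X) : Convex ℝ X := R.strongConvex.1

lemma hasDerivWithinAt_line (R : Regularizer X) {x y : Vec d} (hx : x ∈ X) (hy : y ∈ X)
    {t : ℝ} (ht : t ∈ Set.Icc (0 : ℝ) 1) :
    HasDerivWithinAt (fun s : ℝ => R.toFun (x + s • (y - x)))
      (inner ℝ (R.grad (x + t • (y - x))) (y - x)) (Set.Icc 0 1) t := by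
  have hmaps : Set.MapsTo (fun s : ℝ => x + s • (y - x)) (Set.Icc 0 1) X := fun s hs =>
    R.convex.add_smul_sub_mem hx hy hs
  have h1 := (R.hasGradient _ (hmaps ht)).hasFDerivWithinAt
  have h2 : HasDerivWithinAt (fun s : ℝ => x + s • (y - x)) (y - x) (Set.Icc 0 1) t := by
    simpa using (((hasDerivAt_id t).smul_const (y - x)).const_add x).hasDerivWithinAt
  have h3 := HasFDerivWithinAt.comp_hasDerivWithinAt t h1 h2 hmaps
  simpa [Function.comp_def] using h3

/-- Subtracting `½‖·‖²` leaves a function convex along the segment, whose one-sided slope at `0` is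
at most its secant slope. -/
lemma half_sq_le_breg (R : Regularizer X) {x y : Vec d} (hx : x ∈ X) (hy : y ∈ X) :
    1 / 2 * ‖y - x‖ ^ 2 ≤ R.breg y x := by
  have hconv := strongConvexOn_iff_convex.1 R.strongConvex
  have hline : ConvexOn ℝ (Set.Icc (0 : ℝ) 1)
      (fun s : ℝ => R.toFun (x + s • (y - x)) - 1 / 2 * ‖x + s • (y - x)‖ ^ 2) := by
    have h := hconv.comp_affineMap (AffineMap.lineMap x y : ℝ →ᵃ[ℝ] Vec d)
    have h' := h.subset (s := Set.Icc (0 : ℝ) 1) (fun s hs => by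
      simpa [AffineMap.lineMap_apply, add_comm] using R.convex.add_smul_sub_mem hx hy hs)
      (convex_Icc 0 1)
    refine h'.congr fun s _ => ?_
    simp [AffineMap.lineMap_apply, add_comm]
  have h0 : (0 : ℝ) ∈ Set.Icc (0 : ℝ) 1 := by simp
  have h1 : (1 : ℝ) ∈ Set.Icc (0 : ℝ) 1 := by simp
  have hd := R.hasDerivWithinAt_line hx hy h0
  have hq : HasDerivWithinAt (fun s : ℝ => 1 / 2 * ‖x + s • (y - x)‖ ^ 2)
      (inner ℝ x (y - x)) (Set.Icc 0 1) 0 := by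
    have h2 : HasDerivAt (fun s : ℝ => x + s • (y - x)) (y - x) 0 := by
      simpa using ((hasDerivAt_id (0 : ℝ)).smul_const (y - x)).const_add x
    have h3 := (h2.norm_sq.const_mul (1 / 2 : ℝ)).hasDerivWithinAt (s := Set.Icc (0 : ℝ) 1)
    refine h3.congr_deriv ?_
    simp
  have hs := hline.le_slope_of_hasDerivWithinAt h0 h1 one_pos (hd.sub hq)
  simp only [slope_def_field, zero_smul, add_zero, one_smul, add_sub_cancel, sub_zero, div_one] at hs
  have e1 : ‖y - x‖ ^ 2 = ‖y‖ ^ 2 - 2 * inner ℝ x y + ‖x‖ ^ 2 := by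
    rw [norm_sub_sq_real, real_inner_comm]
  have e2 : inner ℝ x (y - x) = inner ℝ x y - ‖x‖ ^ 2 := by
    rw [inner_sub_right, real_inner_self_eq_norm_sq]
  unfold breg
  nlinarith

lemma breg_nonneg (R : Regularizer X) {x y : Vec d} (hx : x ∈ X) (hy : y ∈ X) :
    0 ≤ R.breg y x :=
  le_trans (by positivity) (R.half_sq_le_breg hx hy)

/-- Along the segment, the function minus its linearization minus the quadratic has nonpositive
derivative. -/
lemma breg_le_half_mul_sq (R : Regularizer X) {x y : Vec d} (hx : x ∈ X) (hy : y ∈ X) :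
    R.breg y x ≤ R.L / 2 * ‖y - x‖ ^ 2 := by
  set p : ℝ := inner ℝ (R.grad x) (y - x) with hp
  let f : ℝ → ℝ := fun s => R.toFun (x + s • (y - x)) - s * p - R.L / 2 * ‖y - x‖ ^ 2 * s ^ 2
  have hder : ∀ t ∈ Set.Icc (0 : ℝ) 1, HasDerivWithinAt f
      (inner ℝ (R.grad (x + t • (y - x))) (y - x) - p - R.L * ‖y - x‖ ^ 2 * t)
      (Set.Icc 0 1) t := by
    intro t ht
    have h1 := R.hasDerivWithinAt_line hx hy ht
    have h2 : HasDerivWithinAt (fun s : ℝ => s * p) p (Set.Icc 0 1) t := by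
      simpa using ((hasDerivAt_id t).mul_const p).hasDerivWithinAt
    have h3 : HasDerivWithinAt (fun s : ℝ => R.L / 2 * ‖y - x‖ ^ 2 * s ^ 2)
        (R.L * ‖y - x‖ ^ 2 * t) (Set.Icc 0 1) t := by
      have h := ((hasDerivAt_pow 2 t).const_mul (R.L / 2 * ‖y - x‖ ^ 2)).hasDerivWithinAt
        (s := Set.Icc (0 : ℝ) 1)
      refine h.congr_deriv ?_
      norm_num; ring
    exact (h1.sub h2).sub h3
  have hanti : AntitoneOn f (Set.Icc 0 1) := by
    refine antitoneOn_of_hasDerivWithinAt_nonpos (convex_Icc 0 1)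
      (fun t ht => (hder t ht).continuousWithinAt)
      (fun t ht => (hder t (interior_subset ht)).mono interior_subset) (fun t ht => ?_)
    have ht' : t ∈ Set.Icc (0 : ℝ) 1 := interior_subset ht
    have hz := R.convex.add_smul_sub_mem hx hy ht'
    have hL := R.smooth _ hz x hx
    have hn : ‖x + t • (y - x) - x‖ = t * ‖y - x‖ := by
      rw [add_sub_cancel_left, norm_smul, Real.norm_of_nonneg ht'.1]
    rw [hn] at hL
    have h := real_inner_le_norm (R.grad (x + t • (y - x)) - R.grad x) (y - x)
    rw [inner_sub_left] at h
    have h' := mul_le_mul_of_nonneg_right hL (norm_nonneg (y - x))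
    rw [hp]
    nlinarith
  have h := hanti (by simp) (by simp) (zero_le_one' ℝ)
  simp only [f, one_smul, zero_smul, add_sub_cancel, add_zero] at h
  unfold breg
  linarith

lemma breg_three_point (R : Regularizer X) (u x y : Vec d) :
    inner ℝ (R.grad x - R.grad y) (u - x) = R.breg u y - R.breg u x - R.breg x y := by
  unfold breg
  have : u - y = (u - x) + (x - y) := by abel
  rw [this, inner_add_right, inner_sub_left]
  ring

/-- Compactness bounds the set of divergences, so that `omega` is a genuine supremum and not a
default value. -/
lemma breg_le_omega (R : Regularizer X) (hX : IsCompact X) {x y : Vec d} (hx : x ∈ X)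
    (hy : y ∈ X) : R.breg y x ≤ R.omega := by
  refine le_csSup ?_ ⟨y, hy, x, hx, rfl⟩
  obtain ⟨D, hD⟩ := hX.isBounded.exists_norm_le
  refine ⟨|R.L| / 2 * (2 * D) ^ 2, ?_⟩
  rintro r ⟨a, ha, b, hb, rfl⟩
  refine (R.breg_le_half_mul_sq hb ha).trans ?_
  have : ‖a - b‖ ≤ 2 * D := (norm_sub_le a b).trans (by linarith [hD a ha, hD b hb])
  gcongr
  exact le_abs_self _

lemma norm_sub_sq_le_omega (R : Regularizer X) (hX : IsCompact X) {x y : Vec d} (hx : x ∈ X)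
    (hy : y ∈ X) : ‖y - x‖ ^ 2 ≤ 2 * R.omega := by
  linarith [R.half_sq_le_breg hx hy, R.breg_le_omega hX hx hy]

lemma norm_sub_le_sqrt (R : Regularizer X) (hX : IsCompact X) {w : ℝ} (hw : R.omega ≤ w)
    {x y : Vec d} (hx : x ∈ X) (hy : y ∈ X) : ‖y - x‖ ≤ Real.sqrt (2 * w) :=
  Real.le_sqrt_of_sq_le ((R.norm_sub_sq_le_omega hX hx hy).trans (by linarith))

lemma one_le_L (R : Regularizer X) {x y : Vec d} (hx : x ∈ X) (hy : y ∈ X) (hxy : x ≠ y) :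
    1 ≤ R.L := by
  have h1 := R.half_sq_le_breg hx hy
  have h2 := R.breg_le_half_mul_sq hx hy
  have h3 : 0 < ‖y - x‖ ^ 2 := by
    have := norm_pos_iff.2 (sub_ne_zero.2 hxy.symm)
    positivity
  by_contra! h
  nlinarith

/-- An approximate minimizer of the proximal objective has a small Frank-Wolfe gap. -/
lemma gap_le_of_isAPO (R : Regularizer X) {v c x' u : Vec d} {η ε γ D : ℝ}
    (hγ : 0 < γ) (hγ1 : γ ≤ 1) (hD : ∀ x ∈ X, ∀ y ∈ X, ‖x - y‖ ≤ D)
    (h : IsAPO R (fun z => η * inner ℝ v z) c ε x') (hu : u ∈ X) :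
    inner ℝ (η • v + R.grad x' - R.grad c) (x' - u) ≤ ε / γ + γ * (|R.L| / 2 * D ^ 2) := by
  obtain ⟨hx', hmin⟩ := h
  -- Moving a fraction `γ` towards `u` gains `γ` times the gap and loses only a term quadratic in
  -- `γ`.
  set z : Vec d := x' + γ • (u - x') with hz
  have hzX : z ∈ X := R.convex.add_smul_sub_mem hx' hu ⟨hγ.le, hγ1⟩
  have h1 := hmin z hzX
  have h2 := R.breg_le_half_mul_sq hx' hzX
  have h3 := R.breg_three_point z x' c
  have hzx : z - x' = γ • (u - x') := by simp [hz]
  rw [hzx, norm_smul, Real.norm_of_nonneg hγ.le] at h2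
  rw [hzx, real_inner_smul_right] at h3
  have h4 : inner ℝ v z = inner ℝ v x' + γ * inner ℝ v (u - x') := by
    rw [hz, inner_add_right, real_inner_smul_right]
  simp only [h4] at h1
  have h5 : R.L / 2 * (γ * ‖u - x'‖) ^ 2 ≤ |R.L| / 2 * (γ * D) ^ 2 := by
    gcongr
    · exact le_abs_self _
    · exact hD u hu x' hx'
  have h6 : inner ℝ (η • v + R.grad x' - R.grad c) (x' - u)
      = -(η * inner ℝ v (u - x') + inner ℝ (R.grad x' - R.grad c) (u - x')) := by
    rw [← neg_sub u x', inner_neg_right, add_sub_assoc, inner_add_left, real_inner_smul_left]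
  rw [h6]
  have h7 : ε / γ + γ * (|R.L| / 2 * D ^ 2) = (ε + |R.L| / 2 * (γ * D) ^ 2) / γ := by
    field_simp
  rw [h7, le_div_iff₀ hγ]
  nlinarith

end Regularizer

end Regularizers

end PolyGame

namespace PolyGame

/-! ### Reflected mirror descent for a single player. -/

section MirrorDescent

variable {d : ℕ} {X : Set (Vec d)}

/-- Regret of optimistic mirror descent with corrected losses `v t = ℓ t - (e t - e (t - 1))`. -/
lemma Regularizer.sum_inner_le_of_gap (R : Regularizer X) {x ℓ v e : ℕ → Vec d} {g : ℕ → ℝ}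
    {η : ℝ} {u : Vec d} (he : e 0 = 0) :
    ∀ T : ℕ, (∀ t ≤ T, x t ∈ X) →
    (∀ t < T, ℓ (t + 1) = v (t + 1) + (e (t + 1) - e t)) →
    (∀ t < T, inner ℝ (η • v (t + 1) + R.grad (x (t + 1)) - R.grad (x t)) (x (t + 1) - u)
      ≤ g (t + 1)) →
    η * ∑ t ∈ Finset.Icc 1 T, inner ℝ (ℓ t) (x t - u) ≤
      R.breg u (x 0) - R.breg u (x T) + ∑ t ∈ Finset.Icc 1 T, g t
        + η * inner ℝ (e T) (x T - u) + η ^ 2 / 2 * ∑ t ∈ Finset.range T, ‖e t‖ ^ 2 := by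
  intro T
  induction T with
  | zero => intro _ _ _; simp [he]
  | succ T ih =>
    intro hx hv hg
    have ih' := ih (fun t ht => hx t (by omega)) (fun t ht => hv t (by omega))
      (fun t ht => hg t (by omega))
    rw [Finset.sum_Icc_succ_top (by omega), Finset.sum_Icc_succ_top (by omega),
      Finset.sum_range_succ]
    have h1 := hg T (by omega)
    have h2 := R.breg_three_point u (x (T + 1)) (x T)
    have h3 := R.half_sq_le_breg (hx T (by omega)) (hx (T + 1) le_rfl)
    rw [add_sub_assoc, inner_add_left, real_inner_smul_left] at h1
    have h4 : inner ℝ (R.grad (x (T + 1)) - R.grad (x T)) (x (T + 1) - u)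
        = -inner ℝ (R.grad (x (T + 1)) - R.grad (x T)) (u - x (T + 1)) := by
      rw [← inner_neg_right, neg_sub]
    -- Summation by parts: the increment of `e` is moved onto the iterates.
    have h5 : inner ℝ (ℓ (T + 1)) (x (T + 1) - u) = inner ℝ (v (T + 1)) (x (T + 1) - u)
        + inner ℝ (e (T + 1)) (x (T + 1) - u) - inner ℝ (e T) (x T - u)
        - inner ℝ (e T) (x (T + 1) - x T) := by
      rw [hv T (by omega), inner_add_left, inner_sub_left]
      simp only [inner_sub_right]
      ring
    -- Young's inequality with exactly the quadratic term that strong convexity provides in `h3`.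
    have h6 : -(η * inner ℝ (e T) (x (T + 1) - x T))
        ≤ η ^ 2 / 2 * ‖e T‖ ^ 2 + 1 / 2 * ‖x (T + 1) - x T‖ ^ 2 := by
      have h := sq_nonneg ‖η • e T + (x (T + 1) - x T)‖
      rw [norm_add_sq_real, norm_smul, real_inner_smul_left, mul_pow, Real.norm_eq_abs, sq_abs] at h
      linarith
    rw [h5]
    nlinarith

/-- Stability of one step of mirror descent. -/
lemma Regularizer.norm_sub_sq_le_of_gap (R : Regularizer X) {x y v : Vec d} {g η : ℝ}
    (hx : x ∈ X) (hy : y ∈ X) (hη : 0 ≤ η) (hv : ‖v‖ ≤ 3)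
    (hg : inner ℝ (η • v + R.grad x - R.grad y) (x - y) ≤ g) :
    ‖x - y‖ ^ 2 ≤ 2 * g + 9 * η ^ 2 := by
  rw [add_sub_assoc, inner_add_left, real_inner_smul_left] at hg
  have h2 := R.breg_three_point y x y
  have h3 := R.half_sq_le_breg hy hx
  have h4 := R.half_sq_le_breg hx hy
  have h5 : R.breg y y = 0 := by simp [Regularizer.breg]
  have h6 : inner ℝ (R.grad x - R.grad y) (x - y)
      = -inner ℝ (R.grad x - R.grad y) (y - x) := by rw [← inner_neg_right, neg_sub]
  have h7 : -(3 * ‖x - y‖) ≤ inner ℝ v (x - y) := by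
    have := (abs_le.1 (abs_real_inner_le_norm v (x - y))).1
    have := mul_le_mul_of_nonneg_right hv (norm_nonneg (x - y))
    linarith
  have h8 := mul_le_mul_of_nonneg_left h7 hη
  rw [norm_sub_rev y x] at h4
  -- The two divergences add up to at least `‖x - y‖²`, so `‖x - y‖² ≤ g + 3η‖x - y‖`; complete the
  -- square.
  nlinarith [sq_nonneg (‖x - y‖ - 3 * η)]

end MirrorDescent

/-! ### Individual regret in self-play. -/

namespace Game

variable {N : ℕ} (G : Game N)

lemma isCompact_X (i : Fin N) : IsCompact (G.X i) :=
  (G.V i).finite_toSet.isCompact_convexHull ℝ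

lemma X_nonempty (i : Fin N) : (G.X i).Nonempty :=
  (Finset.coe_nonempty.2 (G.nonempty i)).convexHull

/-- In every round `1, …, T` the Frank-Wolfe gap of the proximal objective of player `i` at the
chosen point is at most `g i t`. -/
def IsGapRun (R : ∀ i, Regularizer (G.X i)) (η : ℝ) (g : Fin N → ℕ → ℝ) (T : ℕ)
    (x : ℕ → G.Profile) : Prop :=
  (∀ t ≤ T, ∀ i, x t i ∈ G.X i) ∧ ∀ t ∈ Finset.Icc 1 T, ∀ i, ∀ u ∈ G.X i,
    inner ℝ (G.proxGrad R η x i t (x t i)) (x t i - u) ≤ g i t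

section

variable {G} {R : ∀ i, Regularizer (G.X i)} {η : ℝ} {g : Fin N → ℕ → ℝ} {T : ℕ}
  {x : ℕ → G.Profile}

lemma norm_lossAt_le_one (hG : G.Normalized) {t : ℕ} (hx : ∀ i, x t i ∈ G.X i) (i : Fin N) :
    ‖G.lossAt x i t‖ ≤ 1 := by
  unfold lossAt
  split_ifs
  · simp
  · exact hG.loss_le_one i _ hx

lemma norm_predAt_le_one (hG : G.Normalized) {t : ℕ} (hx : ∀ s < t, ∀ i, x s i ∈ G.X i)
    (i : Fin N) : ‖G.predAt x i t‖ ≤ 1 := by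
  unfold predAt
  split_ifs
  · simp
  · exact norm_lossAt_le_one hG (hx _ (by omega)) i

lemma norm_stepVec_le_three (hG : G.Normalized) {t : ℕ} (ht : 1 ≤ t)
    (hx : ∀ s < t, ∀ i, x s i ∈ G.X i) (i : Fin N) : ‖G.stepVec x i t‖ ≤ 3 := by
  unfold stepVec
  have h1 := norm_lossAt_le_one hG (hx (t - 1) (by omega)) i
  have h2 := norm_predAt_le_one hG hx i
  have h3 := norm_predAt_le_one hG (t := t - 1) (fun s hs => hx s (by omega)) i
  exact (norm_sub_le _ _).trans (by linarith [norm_add_le (G.lossAt x i (t - 1)) (G.predAt x i t)])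

lemma IsGapRun.nonneg (h : G.IsGapRun R η g T x) {t : ℕ} (ht : t ∈ Finset.Icc 1 T) (i : Fin N) :
    0 ≤ g i t := by
  simpa using h.2 t ht i (x t i) (h.1 t (Finset.mem_Icc.1 ht).2 i)

lemma IsGapRun.norm_sub_sq_le (hG : G.Normalized) (hη : 0 ≤ η) (h : G.IsGapRun R η g T x)
    {t : ℕ} (ht : t ∈ Finset.Icc 1 T) (i : Fin N) :
    ‖x t i - x (t - 1) i‖ ^ 2 ≤ 2 * g i t + 9 * η ^ 2 := by
  obtain ⟨h1, h2⟩ := Finset.mem_Icc.1 ht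
  have hy := h.1 (t - 1) (by omega) i
  exact (R i).norm_sub_sq_le_of_gap (h.1 t h2 i) hy hη
    (norm_stepVec_le_three hG h1 (fun s hs => h.1 s (by omega)) i) (h.2 t ht i _ hy)

/-- The index starts at `2` because `ℓ⁰ = 0` is a convention, not the loss at `x⁰`: only from round
`2` on is the prediction error a difference of two losses. -/
lemma IsGapRun.norm_loss_diff_sq_le (hG : G.Normalized) (hη : 0 ≤ η) (h : G.IsGapRun R η g T x)
    {t : ℕ} (ht : t + 2 ≤ T) (i : Fin N) :
    ‖G.lossAt x i (t + 2) - G.predAt x i (t + 2)‖ ^ 2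
      ≤ N * ∑ j, (2 * g j (t + 2) + 9 * η ^ 2) := by
  have e : G.lossAt x i (t + 2) - G.predAt x i (t + 2)
      = G.loss i (x (t + 2)) - G.loss i (x (t + 1)) := by
    simp [lossAt, predAt]
  rw [e]
  have h1 := hG.loss_smooth i _ _ (h.1 (t + 2) ht) (h.1 (t + 1) (by omega))
  have h2 : ‖G.loss i (x (t + 2)) - G.loss i (x (t + 1))‖
      ≤ ∑ j, ‖x (t + 2) j - x (t + 1) j‖ :=
    h1.trans (Finset.sum_le_sum_of_subset_of_nonneg (Finset.erase_subset _ _)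
      fun _ _ _ => norm_nonneg _)
  calc _ ≤ (∑ j, ‖x (t + 2) j - x (t + 1) j‖) ^ 2 := by gcongr
    _ ≤ N * ∑ j, ‖x (t + 2) j - x (t + 1) j‖ ^ 2 := by
        simpa using sq_sum_le_card_mul_sum_sq (s := Finset.univ)
          (f := fun j => ‖x (t + 2) j - x (t + 1) j‖)
    _ ≤ _ := by
        gcongr with j
        exact h.norm_sub_sq_le hG hη (Finset.mem_Icc.2 ⟨by omega, ht⟩) j

lemma IsGapRun.sum_norm_loss_diff_sq_le (hG : G.Normalized) (hη : 0 ≤ η)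
    (h : G.IsGapRun R η g T x) (i : Fin N) :
    ∑ t ∈ Finset.range T, ‖G.lossAt x i t - G.predAt x i t‖ ^ 2
      ≤ 1 + N * (2 * ∑ j, ∑ t ∈ Finset.Icc 1 T, g j t + 9 * N * η ^ 2 * T) := by
  have key : N * (2 * ∑ j, ∑ t ∈ Finset.Icc 1 T, g j t + 9 * N * η ^ 2 * T)
      = ∑ t ∈ Finset.Icc 1 T, (N : ℝ) * ∑ j, (2 * g j t + 9 * η ^ 2) := by
    rw [← Finset.mul_sum, Finset.sum_comm]
    simp only [Finset.sum_add_distrib, ← Finset.mul_sum, Finset.sum_const, Finset.card_univ,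
      Fintype.card_fin, Nat.card_Icc, nsmul_eq_mul, Nat.add_sub_cancel]
    ring
  have hnn : ∀ t ∈ Finset.Icc 1 T, (0 : ℝ) ≤ N * ∑ j, (2 * g j t + 9 * η ^ 2) := fun t ht =>
    mul_nonneg (Nat.cast_nonneg _) (Finset.sum_nonneg fun j _ => by
      have := h.nonneg ht j
      positivity)
  rw [key]
  -- Round `0` contributes nothing and round `1`, with prediction `0`, at most `1`.
  have hle : ∀ t ∈ Finset.range T, ‖G.lossAt x i t - G.predAt x i t‖ ^ 2
      ≤ (if t = 1 then 1 else 0)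
        + (if t ∈ Finset.Icc 1 T then (N : ℝ) * ∑ j, (2 * g j t + 9 * η ^ 2) else 0) := by
    intro t ht
    have ht' := Finset.mem_range.1 ht
    match t with
    | 0 => simp [lossAt, predAt]
    | 1 =>
      have h1 := norm_lossAt_le_one hG (h.1 1 ht'.le) i
      have hm : (1 : ℕ) ∈ Finset.Icc 1 T := by simp; omega
      have h2 := hnn 1 hm
      have h3 : G.predAt x i 1 = 0 := by simp [predAt, lossAt]
      rw [h3, sub_zero, if_pos rfl, if_pos hm]
      have : ‖G.lossAt x i 1‖ ^ 2 ≤ 1 := pow_le_one₀ (norm_nonneg _) h1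
      linarith
    | t + 2 =>
      have hm : t + 2 ∈ Finset.Icc 1 T := by simp; omega
      rw [if_pos hm, if_neg (by omega), zero_add]
      exact h.norm_loss_diff_sq_le hG hη (by omega) i
  refine (Finset.sum_le_sum hle).trans ?_
  rw [Finset.sum_add_distrib]
  gcongr
  · rw [Finset.sum_ite_eq']
    split_ifs <;> norm_num
  · rw [← Finset.sum_filter]
    refine Finset.sum_le_sum_of_subset_of_nonneg ?_ (fun t ht _ => hnn t ht)
    intro t ht
    exact (Finset.mem_filter.1 ht).2

/-- Individual regret in self-play when the proximal objectives are minimized up to Frank-Wolfe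
gaps `g i t`. -/
lemma IsGapRun.mul_regret_le (hG : G.Normalized) (hη : 0 < η) {w : ℝ}
    (hw : ∀ i, (R i).omega ≤ w) (h : G.IsGapRun R η g T x) (i : Fin N) :
    η * G.regret x i T ≤ w + ∑ t ∈ Finset.Icc 1 T, g i t + 2 * η * Real.sqrt (2 * w)
      + η ^ 2 / 2 * (1 + N * (2 * ∑ j, ∑ t ∈ Finset.Icc 1 T, g j t + 9 * N * η ^ 2 * T)) := by
  rw [← le_div_iff₀' hη]
  refine csSup_le ((G.X_nonempty i).image _) ?_
  rintro _ ⟨u, hu, rfl⟩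
  simp only [← inner_sub_right]
  rw [le_div_iff₀' hη]
  have h1 := (R i).sum_inner_le_of_gap (x := fun t => x t i) (ℓ := fun t => G.lossAt x i t)
    (v := fun t => G.stepVec x i t) (e := fun t => G.lossAt x i t - G.predAt x i t)
    (g := fun t => g i t) (η := η) (u := u) (by simp [lossAt, predAt]) T (fun t ht => h.1 t ht i)
    (fun t _ => by simp only [stepVec, Nat.add_sub_cancel]; abel)
    (fun t ht => by
      simpa [proxGrad] using h.2 (t + 1) (Finset.mem_Icc.2 ⟨by omega, ht⟩) i u hu)
  have h2 := h.sum_norm_loss_diff_sq_le hG hη.le i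
  have h3 : inner ℝ (G.lossAt x i T - G.predAt x i T) (x T i - u) ≤ 2 * Real.sqrt (2 * w) := by
    refine (real_inner_le_norm _ _).trans ?_
    gcongr
    · refine (norm_sub_le _ _).trans ?_
      linarith [norm_lossAt_le_one hG (h.1 T le_rfl) i,
        norm_predAt_le_one hG (fun s (hs : s < T) => h.1 s hs.le) i]
    · exact (R i).norm_sub_le_sqrt (G.isCompact_X i) (hw i) hu (h.1 T le_rfl i)
  have h4 := ((R i).breg_le_omega (G.isCompact_X i) (h.1 0 (by omega) i) hu).trans (hw i)
  have h5 := (R i).breg_nonneg (h.1 T le_rfl i) hu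
  have h6 := mul_le_mul_of_nonneg_left h3 hη.le
  have h7 := mul_le_mul_of_nonneg_left h2 (by positivity : 0 ≤ η ^ 2 / 2)
  linarith

end

/-! ### From regret to coarse correlated equilibria. -/

section Equilibria

variable {G}

/-- The utility is linear in the player's own block, so the gradient represents it exactly. -/
lemma inner_loss (i : Fin N) (x : G.Profile) (y : Vec (G.n i)) :
    inner ℝ (G.loss i x) y = -G.u i (Function.update x i y) := by
  have h : HasFDerivAt (fun y => G.u i (Function.update x i y))
      (LinearMap.toContinuousLinearMap ((G.u i).toLinearMap x i)) (x i) :=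
    (LinearMap.toContinuousLinearMap ((G.u i).toLinearMap x i)).hasFDerivAt
  rw [loss, inner_neg_left, inner_gradient_left, h.fderiv]
  rfl

lemma sum_prod_mul_u {w : ∀ i, G.V i → ℝ} (i : Fin N) (p : ∀ j, G.V j → Vec (G.n j)) :
    ∑ a : G.PureProfile, (∏ j, w j (a j)) * G.u i (fun j => p j (a j))
      = G.u i (fun j => ∑ v : G.V j, w j v • p j v) := by
  classical
  rw [MultilinearMap.map_sum]
  refine Finset.sum_congr rfl fun a _ => ?_
  rw [(G.u i).map_smul_univ (fun j => w j (a j)) (fun j => p j (a j)), smul_eq_mul]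

/-- Case of `sum_prod_mul_u` with all atoms of player `i` moved to `b`; the weights of total mass
`1` then average to `b`. -/
lemma sum_prod_mul_u_update {w : ∀ i, G.V i → ℝ} (hw : ∀ i, ∑ v, w i v = 1) (i : Fin N)
    (b : Vec (G.n i)) :
    ∑ a : G.PureProfile, (∏ j, w j (a j))
        * G.u i (Function.update (fun j => (a j : Vec (G.n j))) i b)
      = G.u i (Function.update (fun j => ∑ v : G.V j, w j v • (v : Vec (G.n j))) i b) := by
  have h := sum_prod_mul_u (w := w) i
    (Function.update (fun j (v : G.V j) => (v : Vec (G.n j))) i (fun _ => b))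
  have e1 : ∀ a : G.PureProfile,
      (fun j => Function.update (fun j (v : G.V j) => (v : Vec (G.n j))) i (fun _ => b) j (a j))
        = Function.update (fun j => (a j : Vec (G.n j))) i b := by
    intro a
    funext j
    by_cases hj : j = i
    · subst hj; simp
    · simp [hj]
  have e2 : (fun j => ∑ v : G.V j, w j v •
      Function.update (fun j (v : G.V j) => (v : Vec (G.n j))) i (fun _ => b) j v)
        = Function.update (fun j => ∑ v : G.V j, w j v • (v : Vec (G.n j))) i b := by
    funext j
    by_cases hj : j = i
    · subst hj
      simp only [Function.update_self]
      rw [← Finset.sum_smul, hw, one_smul]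
    · simp [hj]
  simp only [e1, e2] at h
  exact h

lemma sum_le_regret (x : ℕ → G.Profile) (i : Fin N) (T : ℕ) {u : Vec (G.n i)} (hu : u ∈ G.X i) :
    ∑ t ∈ Finset.Icc 1 T, (inner ℝ (G.lossAt x i t) (x t i) - inner ℝ (G.lossAt x i t) u)
      ≤ G.regret x i T := by
  refine le_csSup ((G.isCompact_X i).image ?_).bddAbove ⟨u, hu, rfl⟩
  fun_prop

/-- Regret against a fixed vertex is `T` times the gain from deviating to it under the average joint
strategy. -/
lemma isCCE_avgJoint {T : ℕ} (hT : 0 < T) {x : ℕ → G.Profile} {w : ℕ → ∀ i, G.V i → ℝ} {ε : ℝ}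
    (hw : G.Represents T x w) (hreg : ∀ i, G.regret x i T ≤ T * ε) :
    G.IsCCE (G.avgJoint T w) ε := by
  have hT' : (0 : ℝ) < T := Nat.cast_pos.2 hT
  have swap : ∀ F : G.PureProfile → ℝ, ∑ a, G.avgJoint T w a * F a
      = (1 / (T : ℝ)) * ∑ t ∈ Finset.Icc 1 T, ∑ a : G.PureProfile, (∏ i, w t i (a i)) * F a := by
    intro F
    rw [Finset.sum_comm, Finset.mul_sum]
    refine Finset.sum_congr rfl fun a _ => ?_
    rw [avgJoint, mul_assoc, Finset.sum_mul]
  refine ⟨⟨fun a => ?_, ?_⟩, fun i a' => ?_⟩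
  · refine mul_nonneg (by positivity) (Finset.sum_nonneg fun t ht => Finset.prod_nonneg fun i _ => ?_)
    exact (hw t ht i).1.1 _
  · have h := swap (fun _ => 1)
    simp only [mul_one] at h
    rw [h, Finset.sum_congr rfl (g := fun _ => (1 : ℝ))]
    · simp [hT'.ne']
    · intro t ht
      rw [← Fintype.prod_sum]
      exact Finset.prod_eq_one fun i _ => (hw t ht i).1.2
  · rw [swap, swap]
    have h1 := (sum_le_regret x i T (subset_convexHull ℝ _ a'.2)).trans (hreg i)
    have h2 : ∀ t ∈ Finset.Icc 1 T,
        inner ℝ (G.lossAt x i t) (x t i) - inner ℝ (G.lossAt x i t) (a' : Vec (G.n i))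
        = ∑ a : G.PureProfile, (∏ j, w t j (a j))
            * G.u i (Function.update (fun j => (a j : Vec (G.n j))) i (a' : Vec (G.n i)))
          - ∑ a : G.PureProfile, (∏ j, w t j (a j)) * G.u i (fun j => (a j : Vec (G.n j))) := by
      intro t ht
      have ht0 : t ≠ 0 := by have := (Finset.mem_Icc.1 ht).1; omega
      rw [sum_prod_mul_u_update (fun j => (hw t ht j).1.2), sum_prod_mul_u i (fun j v => (v : _))]
      have e : (fun j => ∑ v : G.V j, w t j v • (v : Vec (G.n j))) = x t :=
        funext fun j => (hw t ht j).2
      rw [e, lossAt, if_neg ht0, inner_loss, inner_loss, Function.update_eq_self]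
      ring
    rw [Finset.sum_congr rfl h2, Finset.sum_sub_distrib] at h1
    rw [ge_iff_le, sub_le_iff_le_add, ← sub_le_iff_le_add', ← mul_sub, one_div,
      inv_mul_le_iff₀ hT']
    exact h1

end Equilibria

end Game

end PolyGame

namespace PolyGame

/-! ### Exposed faces of polytopes and the facial distance. -/

section FacialDistance

variable {d : ℕ}

lemma setDist_nonneg (s t : Set (Vec d)) : 0 ≤ setDist s t := by
  refine Real.sInf_nonneg ?_
  rintro r ⟨x, _, y, _, rfl⟩
  exact dist_nonneg

lemma setDist_le_dist {s t : Set (Vec d)} {x y : Vec d} (hx : x ∈ s) (hy : y ∈ t) :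
    setDist s t ≤ dist x y := by
  refine csInf_le ⟨0, ?_⟩ ⟨x, hx, y, hy, rfl⟩
  rintro r ⟨x, _, y, _, rfl⟩
  exact dist_nonneg

lemma setDist_pos {s t : Set (Vec d)} (hs : IsCompact s) (ht : IsCompact t) (hsn : s.Nonempty)
    (htn : t.Nonempty) (hst : Disjoint s t) : 0 < setDist s t := by
  obtain ⟨⟨a, b⟩, ⟨ha, hb⟩, hmin⟩ := (hs.prod ht).exists_isMinOn (hsn.prod htn)
    (f := fun p : Vec d × Vec d => dist p.1 p.2) (by fun_prop)
  have hab : a ≠ b := fun h => Set.disjoint_left.1 hst ha (h ▸ hb)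
  refine (dist_pos.2 hab).trans_le (le_csInf ⟨_, a, ha, b, hb, rfl⟩ ?_)
  rintro r ⟨x, hx, y, hy, rfl⟩
  exact hmin (a := (x, y)) ⟨hx, hy⟩

variable {V : Finset (Vec d)} {F : Set (Vec d)}

lemma isCompact_convexHull_finset (V : Finset (Vec d)) :
    IsCompact (convexHull ℝ (V : Set (Vec d))) :=
  V.finite_toSet.isCompact_convexHull ℝ

lemma isCompact_convexHull_diff (V : Finset (Vec d)) (F : Set (Vec d)) :
    IsCompact (convexHull ℝ ((V : Set (Vec d)) \ F)) :=
  (V.finite_toSet.subset Set.sdiff_subset).isCompact_convexHull ℝ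

/-- An exposed face of a polytope is the convex hull of the vertices it contains. -/
lemma exposed_eq_convexHull (hF : IsExposed ℝ (convexHull ℝ (V : Set (Vec d))) F) :
    F = convexHull ℝ ((V : Set (Vec d)) ∩ F) := by
  have hP := isCompact_convexHull_finset V
  have hFc : Convex ℝ F := hF.convex (convex_convexHull ℝ _)
  refine Set.Subset.antisymm ?_ (convexHull_min Set.inter_subset_right hFc)
  have hc : IsClosed (convexHull ℝ ((V : Set (Vec d)) ∩ F)) :=
    ((V.finite_toSet.subset Set.inter_subset_left).isCompact_convexHull ℝ).isClosed
  -- Krein-Milman: extreme points of a face are extreme in the polytope, hence lie in `V`.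
  calc F = closure (convexHull ℝ (F.extremePoints ℝ)) :=
        (closure_convexHull_extremePoints (hF.isCompact hP) hFc).symm
    _ ⊆ convexHull ℝ ((V : Set (Vec d)) ∩ F) := by
        refine closure_minimal (convexHull_mono fun x hx => ⟨?_, hx.1⟩) hc
        exact extremePoints_convexHull_subset (hF.isExtreme.extremePoints_subset_extremePoints hx)

lemma finite_exposed (V : Finset (Vec d)) :
    {F : Set (Vec d) | IsExposed ℝ (convexHull ℝ (V : Set (Vec d))) F}.Finite := by
  refine Set.Finite.of_injOn (f := fun F => (V : Set (Vec d)) ∩ F)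
    (t := {s | s ⊆ (V : Set (Vec d))}) (fun F _ => Set.inter_subset_left) ?_
    V.finite_toSet.finite_subsets
  intro F hF F' hF' h
  rw [exposed_eq_convexHull hF, exposed_eq_convexHull hF']
  exact congrArg _ h

/-- The exposing functional is strictly below its maximum at the vertices off `F`, hence on their
convex hull. -/
lemma disjoint_exposed_convexHull_diff (hF : IsExposed ℝ (convexHull ℝ (V : Set (Vec d))) F)
    (hFn : F.Nonempty) : Disjoint F (convexHull ℝ ((V : Set (Vec d)) \ F)) := by
  obtain ⟨l, hl⟩ := hF hFn
  obtain ⟨z, hz⟩ := hFn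
  have hz' := hz
  rw [hl] at hz'
  have hsub : convexHull ℝ ((V : Set (Vec d)) \ F) ⊆ {x | l x < l z} := by
    refine convexHull_min ?_ (convex_halfSpace_lt l.toLinearMap.isLinear _)
    rintro v ⟨hv, hvF⟩
    by_contra! h
    refine hvF ?_
    rw [hl]
    exact ⟨subset_convexHull ℝ _ hv, fun y hy => (hz'.2 y hy).trans (not_lt.1 h)⟩
  rw [Set.disjoint_left]
  intro x hx hx'
  rw [hl] at hx
  exact absurd (hsub hx') (not_lt.2 (hx.2 z hz'.1))

lemma diff_exposed_nonempty (hF : IsExposed ℝ (convexHull ℝ (V : Set (Vec d))) F)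
    (hFP : F ≠ convexHull ℝ (V : Set (Vec d))) : ((V : Set (Vec d)) \ F).Nonempty := by
  rw [Set.sdiff_nonempty]
  intro h
  exact hFP (hF.subset.antisymm (convexHull_min h (hF.convex (convex_convexHull ℝ _))))

lemma facialDistance_le_setDist (hF : IsExposed ℝ (convexHull ℝ (V : Set (Vec d))) F)
    (hFn : F.Nonempty) (hFP : F ≠ convexHull ℝ (V : Set (Vec d))) :
    facialDistance V ≤ setDist F (convexHull ℝ ((V : Set (Vec d)) \ F)) := by
  refine csInf_le ⟨0, ?_⟩ ⟨F, hF, hFn, hFP, rfl⟩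
  rintro r ⟨F, _, _, _, rfl⟩
  exact setDist_nonneg _ _

lemma facialDistance_nonneg (V : Finset (Vec d)) : 0 ≤ facialDistance V := by
  refine Real.sInf_nonneg ?_
  rintro r ⟨F, _, _, _, rfl⟩
  exact setDist_nonneg _ _

/-- The functional `⟨x - y, ·⟩` is larger at `x` than at `y`, so the face where it is maximal misses
`y`. -/
lemma exists_proper_exposed (hV : 1 < V.card) :
    ∃ F : Set (Vec d), IsExposed ℝ (convexHull ℝ (V : Set (Vec d))) F ∧ F.Nonempty ∧
      F ≠ convexHull ℝ (V : Set (Vec d)) := by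
  obtain ⟨x, hx, y, hy, hxy⟩ := Finset.one_lt_card.1 hV
  have hx' := subset_convexHull ℝ (V : Set (Vec d)) hx
  have hy' := subset_convexHull ℝ (V : Set (Vec d)) hy
  let l : StrongDual ℝ (Vec d) := innerSL ℝ (x - y)
  refine ⟨l.toExposed (convexHull ℝ (V : Set (Vec d))),
    ContinuousLinearMap.toExposed.isExposed, ?_, fun h => ?_⟩
  · obtain ⟨z, hz, hmax⟩ := (isCompact_convexHull_finset V).exists_isMaxOn ⟨x, hx'⟩
      l.continuous.continuousOn
    exact ⟨z, hz, fun y hy => hmax hy⟩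
  · have hyF : y ∈ l.toExposed (convexHull ℝ (V : Set (Vec d))) := by rw [h]; exact hy'
    have h1 : inner ℝ (x - y) x ≤ inner ℝ (x - y) y := hyF.2 x hx'
    have h2 : 0 < inner ℝ (x - y) (x - y) := by
      rw [real_inner_self_eq_norm_sq]
      have := norm_pos_iff.2 (sub_ne_zero.2 hxy)
      positivity
    rw [inner_sub_right] at h2
    linarith

/-- Finitely many faces make the infimum attained. With one vertex there is no proper face and `sInf
∅ = 0`. -/
lemma facialDistance_pos (hV : 1 < V.card) : 0 < facialDistance V := by
  obtain ⟨F, hF, hFn, hFP⟩ := exists_proper_exposed hV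
  obtain ⟨F, hF, hFn, hFP, h⟩ : facialDistance V ∈ {r : ℝ | ∃ F : Set (Vec d),
      IsExposed ℝ (convexHull ℝ (V : Set (Vec d))) F ∧ F.Nonempty ∧
      F ≠ convexHull ℝ (V : Set (Vec d)) ∧
      r = setDist F (convexHull ℝ ((V : Set (Vec d)) \ F))} := by
    refine Set.Nonempty.csInf_mem ⟨_, F, hF, hFn, hFP, rfl⟩ ?_
    refine ((finite_exposed V).image
      fun F => setDist F (convexHull ℝ ((V : Set (Vec d)) \ F))).subset ?_
    rintro r ⟨F, hF, _, _, rfl⟩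
    exact ⟨F, hF, rfl⟩
  rw [h]
  exact setDist_pos (hF.isCompact (isCompact_convexHull_finset V)) (isCompact_convexHull_diff V F)
    hFn (diff_exposed_nonempty hF hFP).convexHull (disjoint_exposed_convexHull_diff hF hFn)

lemma facialDistance_le_diam (hV : 1 < V.card) :
    facialDistance V ≤ Metric.diam (convexHull ℝ (V : Set (Vec d))) := by
  obtain ⟨F, hF, hFn, hFP⟩ := exists_proper_exposed hV
  obtain ⟨v, hv⟩ := diff_exposed_nonempty hF hFP
  obtain ⟨x, hx⟩ := hFn
  refine (facialDistance_le_setDist hF ⟨x, hx⟩ hFP).trans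
    ((setDist_le_dist hx (subset_convexHull ℝ _ hv)).trans ?_)
  exact Metric.dist_le_diam_of_mem (isCompact_convexHull_finset V).isBounded (hF.subset hx)
    (subset_convexHull ℝ _ hv.1)

/-- If the segment from `a` to a point `w` of a polytope cannot be prolonged inside the polytope,
then some exposed face contains `w` but not `a`. -/
lemma exists_exposed_mem_notMem {w a : Vec d} (hw : w ∈ convexHull ℝ (V : Set (Vec d)))
    (ha : ∀ θ : ℝ, 0 < θ → w + θ • (w - a) ∉ convexHull ℝ (V : Set (Vec d))) :
    ∃ F, IsExposed ℝ (convexHull ℝ (V : Set (Vec d))) F ∧ w ∈ F ∧ a ∉ F := by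
  set P := convexHull ℝ (V : Set (Vec d)) with hP
  have hPc : IsCompact P := isCompact_convexHull_finset V
  have hPconv : Convex ℝ P := convex_convexHull ℝ _
  -- The finitely many faces missing `w` have a closed union, so some ball around `w` avoids them.
  -- `θ` is chosen to keep the projection `q` of `p` in that ball.
  have hclosed : IsClosed (⋃ F ∈ {F : Set (Vec d) | IsExposed ℝ P F ∧ w ∉ F}, F) :=
    ((finite_exposed V).subset fun F hF => hF.1).isClosed_biUnion
      fun F hF => (hF.1.isCompact hPc).isClosed
  have hwn : w ∈ (⋃ F ∈ {F : Set (Vec d) | IsExposed ℝ P F ∧ w ∉ F}, F)ᶜ := by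
    simp only [Set.mem_compl_iff, Set.mem_iUnion, not_exists]
    exact fun F hF => hF.2
  obtain ⟨r, hr, hball⟩ := Metric.isOpen_iff.1 hclosed.isOpen_compl w hwn
  set θ : ℝ := r / (2 * (‖w - a‖ + 1)) with hθ
  have hden : 0 < 2 * (‖w - a‖ + 1) := by positivity
  have hθpos : 0 < θ := by positivity
  set p := w + θ • (w - a) with hp
  have hpP : p ∉ P := ha θ hθpos
  obtain ⟨q, hq, hqmin⟩ := exists_norm_eq_iInf_of_complete_convex ⟨w, hw⟩ hPc.isComplete hPconv p
  have hproj := (norm_eq_iInf_iff_real_inner_le_zero hPconv hq).1 hqmin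
  have hpq : p - q ≠ 0 := fun h => hpP (by rwa [sub_eq_zero.1 h])
  have hpos : 0 < inner ℝ (p - q) (p - q) := by
    rw [real_inner_self_eq_norm_sq]
    have := norm_pos_iff.2 hpq
    positivity
  have hpw : p - w = θ • (w - a) := by simp [hp]
  have h1 := hproj w hw
  have h2 : inner ℝ (p - q) (w - q) + inner ℝ (p - q) (p - w) = inner ℝ (p - q) (p - q) := by
    rw [← inner_add_right]; congr 1; abel
  rw [hpw, real_inner_smul_right] at h2
  have h3 : 0 < inner ℝ (p - q) (w - a) := by
    by_contra! h
    have := mul_nonpos_of_nonneg_of_nonpos hθpos.le h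
    linarith
  -- The residual exposes a face through `q`. It contains `w` because `q` is near `w`, and misses
  -- `a` because `l` is strictly smaller at `a` than at `w`.
  let l : StrongDual ℝ (Vec d) := innerSL ℝ (p - q)
  have hlq : ∀ y ∈ P, l y ≤ l q := fun y hy => by
    have := hproj y hy
    rw [inner_sub_right] at this
    exact sub_nonpos.1 this
  have hexp : IsExposed ℝ P (l.toExposed P) := ContinuousLinearMap.toExposed.isExposed
  have hdist : ‖q - w‖ < r := by
    have hle : ‖p - q‖ ^ 2 ≤ ‖p - q‖ * ‖p - w‖ := by
      have e := real_inner_le_norm (p - q) (p - w)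
      rw [hpw, real_inner_smul_right] at e
      rw [hpw, ← real_inner_self_eq_norm_sq]
      linarith
    have hle' : ‖p - q‖ ≤ ‖p - w‖ := by
      have := norm_pos_iff.2 hpq
      nlinarith
    have e1 : ‖p - w‖ = θ * ‖w - a‖ := by
      rw [hpw, norm_smul, Real.norm_of_nonneg hθpos.le]
    have e2 : ‖q - w‖ ≤ ‖p - w‖ + ‖p - q‖ := by
      have : q - w = (p - w) - (p - q) := by abel
      rw [this]; exact norm_sub_le _ _
    have e3 : θ * (2 * (‖w - a‖ + 1)) = r := div_mul_cancel₀ r hden.ne'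
    nlinarith
  refine ⟨l.toExposed P, hexp, ?_, fun h => ?_⟩
  · by_contra hcon
    refine hball (a := q) (by rwa [Metric.mem_ball, dist_eq_norm]) ?_
    simp only [Set.mem_iUnion]
    exact ⟨l.toExposed P, ⟨hexp, hcon⟩, hq, hlq⟩
  · have h4 : inner ℝ (p - q) w ≤ inner ℝ (p - q) a := h.2 w hw
    rw [inner_sub_right] at h3
    linarith

/-- Intersect the faces obtained for the single points. For empty `U` the face is the whole
polytope, so properness has to be checked by the user. -/
lemma exists_exposed_avoiding {w : Vec d} (hw : w ∈ convexHull ℝ (V : Set (Vec d)))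
    (U : Finset (Vec d))
    (hU : ∀ a ∈ U, ∀ θ : ℝ, 0 < θ → w + θ • (w - a) ∉ convexHull ℝ (V : Set (Vec d))) :
    ∃ F, IsExposed ℝ (convexHull ℝ (V : Set (Vec d))) F ∧ w ∈ F ∧ ∀ a ∈ U, a ∉ F := by
  classical
  induction U using Finset.induction_on with
  | empty => exact ⟨_, IsExposed.refl _, hw, by simp⟩
  | insert a U _ ih =>
    obtain ⟨F, hF, hwF, hUF⟩ := ih fun b hb => hU b (Finset.mem_insert_of_mem hb)
    obtain ⟨F', hF', hwF', haF'⟩ :=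
      exists_exposed_mem_notMem hw (hU a (Finset.mem_insert_self a U))
    refine ⟨F ∩ F', hF.inter hF', ⟨hwF, hwF'⟩, fun b hb hbF => ?_⟩
    rcases Finset.mem_insert.1 hb with rfl | hb
    · exact haF' hbF.2
    · exact hUF b hb hbF.1

end FacialDistance

end PolyGame

namespace PolyGame

/-! ### Least-mass transport and the pairwise gap. -/

section FacialDistance

variable {d : ℕ} {V : Finset (Vec d)}

/-- Two weight vectors are compared by moving as little mass `κ` as possible: the mass is then moved
from a point `u` of the support of the first one to a point `w` at facial distance from `u`. -/
lemma exists_transport {lam : Vec d → ℝ} (hlam : ∀ v ∈ V, 0 ≤ lam v)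
    (hsum : ∑ v ∈ V, lam v = 1) {y : Vec d} (hy : y ∈ convexHull ℝ (V : Set (Vec d)))
    (hxy : ∑ v ∈ V, lam v • v ≠ y) :
    ∃ (κ : ℝ) (u w : Vec d), 0 < κ ∧ u ∈ convexHull ℝ {v | v ∈ V ∧ 0 < lam v} ∧
      w ∈ convexHull ℝ (V : Set (Vec d)) ∧ ∑ v ∈ V, lam v • v - y = κ • (u - w) ∧
      facialDistance V ≤ ‖u - w‖ := by
  classical
  set x := ∑ v ∈ V, lam v • v with hx
  -- Partial transport plans from `x` to `y`: `p.1` is the mass removed, `p.2` the mass added. The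
  -- cap `p.1 ≤ lam` keeps `u` in the hull of the support.
  let K : Set ((V → ℝ) × (V → ℝ)) := {p | (∀ v, 0 ≤ p.1 v ∧ p.1 v ≤ lam v) ∧ (∀ v, 0 ≤ p.2 v) ∧
    ∑ v, p.2 v = ∑ v, p.1 v ∧
    ∑ v : V, p.1 v • (v : Vec d) - ∑ v : V, p.2 v • (v : Vec d) = x - y}
  have hsumV : ∑ v : V, lam v = 1 := by rw [Finset.sum_coe_sort V lam, hsum]
  have hKc : IsCompact K := by
    refine IsCompact.of_isClosed_subset
      ((isCompact_Icc (a := (0 : V → ℝ)) (b := fun v => lam v)).prod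
        (isCompact_Icc (a := (0 : V → ℝ)) (b := 1))) ?_ ?_
    · have e : K = (⋂ v, {p | 0 ≤ p.1 v}) ∩ (⋂ v : V, {p | p.1 v ≤ lam v}) ∩ (⋂ v, {p | 0 ≤ p.2 v})
          ∩ {p | ∑ v, p.2 v = ∑ v, p.1 v} ∩ {p | ∑ v : V, p.1 v • (v : Vec d)
            - ∑ v : V, p.2 v • (v : Vec d) = x - y} := by
        ext p
        simp only [K, Set.mem_ofPred_eq, Set.mem_inter_iff, Set.mem_iInter, forall_and, and_assoc]
      rw [e]
      refine ((((isClosed_iInter fun v => ?_).inter (isClosed_iInter fun v => ?_)).inter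
        (isClosed_iInter fun v => ?_)).inter ?_).inter ?_
      · exact isClosed_le (by fun_prop) (by fun_prop)
      · exact isClosed_le (by fun_prop) (by fun_prop)
      · exact isClosed_le (by fun_prop) (by fun_prop)
      · exact isClosed_eq (by fun_prop) (by fun_prop)
      · exact isClosed_eq (by fun_prop) (by fun_prop)
    · rintro ⟨α, β⟩ ⟨hα, hβ, hs, _⟩
      refine ⟨⟨fun v => (hα v).1, fun v => (hα v).2⟩, ⟨hβ, fun v => ?_⟩⟩
      calc β v ≤ ∑ v, β v := Finset.single_le_sum (fun v _ => hβ v) (Finset.mem_univ v)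
        _ = ∑ v, α v := hs
        _ ≤ ∑ v : V, lam v := Finset.sum_le_sum fun v _ => (hα v).2
        _ = 1 := hsumV
  obtain ⟨μ, hμ0, hμ1, hμy⟩ := Finset.mem_convexHull'.1 hy
  have hKn : K.Nonempty := by
    refine ⟨(fun v => lam v, fun v => μ v), fun v => ⟨hlam v v.2, le_rfl⟩, fun v => hμ0 v v.2, ?_, ?_⟩
    · change ∑ v : V, μ v = ∑ v : V, lam v
      rw [hsumV, Finset.sum_coe_sort V μ, hμ1]
    · change ∑ v : V, lam v • (v : Vec d) - ∑ v : V, μ v • (v : Vec d) = x - y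
      rw [Finset.sum_coe_sort V (fun v => lam v • v), Finset.sum_coe_sort V (fun v => μ v • v), hμy]
  obtain ⟨⟨α, β⟩, ⟨hα, hβ, hs, hd⟩, hmin⟩ := hKc.exists_isMinOn hKn
    (f := fun p => ∑ v, p.1 v) (by fun_prop)
  dsimp only at hα hβ hs hd
  set κ := ∑ v, α v with hκ
  have hκ0 : 0 ≤ κ := Finset.sum_nonneg fun v _ => (hα v).1
  have hκpos : 0 < κ := by
    refine hκ0.lt_of_ne fun h => hxy ?_
    have h1 : ∀ v, α v = 0 := fun v =>
      (Finset.sum_eq_zero_iff_of_nonneg fun v _ => (hα v).1).1 h.symm v (Finset.mem_univ v)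
    have h2 : ∀ v, β v = 0 := fun v =>
      (Finset.sum_eq_zero_iff_of_nonneg fun v _ => hβ v).1 (hs.trans h.symm) v (Finset.mem_univ v)
    simp only [h1, h2, zero_smul, Finset.sum_const_zero, sub_zero] at hd
    exact sub_eq_zero.1 hd.symm
  set u : Vec d := ∑ v : V, (κ⁻¹ * α v) • (v : Vec d) with hu
  set w : Vec d := ∑ v : V, (κ⁻¹ * β v) • (v : Vec d) with hw
  have hκu : κ • u = ∑ v : V, α v • (v : Vec d) := by
    rw [hu, Finset.smul_sum]
    refine Finset.sum_congr rfl fun v _ => ?_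
    rw [smul_smul, mul_inv_cancel_left₀ hκpos.ne']
  have hκw : κ • w = ∑ v : V, β v • (v : Vec d) := by
    rw [hw, Finset.smul_sum]
    refine Finset.sum_congr rfl fun v _ => ?_
    rw [smul_smul, mul_inv_cancel_left₀ hκpos.ne']
  have hwP : w ∈ convexHull ℝ (V : Set (Vec d)) := by
    refine (convex_convexHull ℝ _).sum_mem (fun v _ => mul_nonneg (by positivity) (hβ v)) ?_
      fun v _ => subset_convexHull ℝ _ v.2
    rw [← Finset.mul_sum, hs, inv_mul_cancel₀ hκpos.ne']
  let U : Finset (Vec d) := (Finset.univ.filter fun v : V => 0 < α v).image Subtype.val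
  have hmemU : ∀ v : V, 0 < α v → (v : Vec d) ∈ U := fun v hv =>
    Finset.mem_image_of_mem _ (Finset.mem_filter.2 ⟨Finset.mem_univ _, hv⟩)
  have huC : ∀ S : Set (Vec d), (∀ v : V, 0 < α v → (v : Vec d) ∈ S) → u ∈ convexHull ℝ S := by
    intro S hS
    have e : u = ∑ v ∈ Finset.univ.filter (fun v : V => 0 < α v), (κ⁻¹ * α v) • (v : Vec d) := by
      rw [hu, Finset.sum_filter_of_ne]
      intro v _ hne
      refine (hα v).1.lt_of_ne fun h => hne ?_
      rw [← h, mul_zero, zero_smul]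
    rw [e]
    refine (convex_convexHull ℝ S).sum_mem (fun v _ => mul_nonneg (by positivity) (hα v).1) ?_
      fun v hv => subset_convexHull ℝ _ (hS v (Finset.mem_filter.1 hv).2)
    rw [Finset.sum_filter_of_ne, ← Finset.mul_sum, inv_mul_cancel₀ hκpos.ne']
    intro v _ hne
    refine (hα v).1.lt_of_ne fun h => hne ?_
    rw [← h, mul_zero]
  -- If the segment from a source `a` to `w` could be prolonged to `z`, then `κ w = ρ z + ρθ a`: the
  -- target could be rewritten with mass at `a` itself. Cancelling the amount `c` there gives a
  -- cheaper plan.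
  obtain ⟨F, hF, hwF, hUF⟩ := exists_exposed_avoiding hwP U (by
    intro b hb θ hθ hz
    obtain ⟨a, ha, rfl⟩ := Finset.mem_image.1 hb
    have hαa := (Finset.mem_filter.1 ha).2
    obtain ⟨ζ, hζ0, hζ1, hζz⟩ := Finset.mem_convexHull'.1 hz
    set ρ := κ / (1 + θ) with hρ
    have hρpos : 0 < ρ := by positivity
    have hρκ : ρ * (1 + θ) = κ := div_mul_cancel₀ _ (by positivity)
    set c := min (α a) (ρ * θ) with hc
    have hcpos : 0 < c := lt_min hαa (by positivity)
    have hsingle : ∀ r : ℝ, ∑ v : V, (if v = a then r else 0) = r := fun r => by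
      rw [Finset.sum_ite_eq' Finset.univ a (fun _ => r), if_pos (Finset.mem_univ a)]
    have hsingle' : ∀ r : ℝ, ∑ v : V, (if v = a then r else 0) • (v : Vec d) = r • (a : Vec d) :=
      fun r => by
        simp only [ite_smul, zero_smul]
        rw [Finset.sum_ite_eq' Finset.univ a (fun v : V => r • (v : Vec d)),
          if_pos (Finset.mem_univ a)]
    have hζ1' : ∑ v : V, ζ v = 1 := by rw [Finset.sum_coe_sort V ζ, hζ1]
    have hζz' : ∑ v : V, ζ v • (v : Vec d) = w + θ • (w - a) := by
      rw [Finset.sum_coe_sort V (fun v => ζ v • v), hζz]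
    have hK' : ((fun v => α v - if v = a then c else 0),
        (fun v : V => ρ * ζ v + if v = a then ρ * θ - c else 0)) ∈ K := by
      refine ⟨fun v => ?_, fun v => ?_, ?_, ?_⟩
      · dsimp only
        split_ifs with h
        · subst h
          exact ⟨sub_nonneg.2 (min_le_left _ _), (sub_le_self _ hcpos.le).trans (hα v).2⟩
        · simpa using hα v
      · dsimp only
        have := mul_nonneg hρpos.le (hζ0 v v.2)
        split_ifs
        · have := min_le_right (α a) (ρ * θ)
          linarith
        · linarith
      · dsimp only
        rw [Finset.sum_add_distrib, Finset.sum_sub_distrib, hsingle, hsingle, ← Finset.mul_sum,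
          hζ1']
        linarith
      · dsimp only
        simp only [sub_smul, add_smul, Finset.sum_add_distrib, Finset.sum_sub_distrib, hsingle',
          mul_smul, ← Finset.smul_sum, hζz']
        rw [← hd, ← hκw, ← hρκ]
        module
    have hle := hmin hK'
    simp only [Set.mem_ofPred_eq, Finset.sum_sub_distrib, hsingle] at hle
    linarith)
  obtain ⟨a, ha⟩ : ∃ a, 0 < α a := by
    by_contra! h
    exact absurd (Finset.sum_nonpos fun v (_ : v ∈ Finset.univ) => h v) (not_le.2 hκpos)
  refine ⟨κ, u, w, hκpos, huC _ fun v hv => ⟨v.2, hv.trans_le (hα v).2⟩, hwP, ?_, ?_⟩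
  · rw [smul_sub, hκu, hκw, hd]
  · have hFP : F ≠ convexHull ℝ (V : Set (Vec d)) := fun h =>
      hUF a (hmemU a ha) (h ▸ subset_convexHull ℝ _ a.2)
    refine (facialDistance_le_setDist hF ⟨w, hwF⟩ hFP).trans ?_
    rw [← dist_eq_norm, dist_comm]
    exact setDist_le_dist hwF (huC _ fun v hv => ⟨v.2, hUF v (hmemU v hv)⟩)

/-- Lower bound on the pairwise Frank-Wolfe gap in terms of the facial distance. -/
lemma facialDistance_mul_inner_le {lam : Vec d → ℝ} (hlam : ∀ v ∈ V, 0 ≤ lam v)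
    (hsum : ∑ v ∈ V, lam v = 1) {y : Vec d} (hy : y ∈ convexHull ℝ (V : Set (Vec d)))
    {g : Vec d} {A B : ℝ} (hA : ∀ v ∈ V, 0 < lam v → inner ℝ g v ≤ A)
    (hB : ∀ v ∈ V, B ≤ inner ℝ g v) :
    facialDistance V * inner ℝ g (∑ v ∈ V, lam v • v - y) ≤
      ‖∑ v ∈ V, lam v • v - y‖ * (A - B) := by
  by_cases hxy : ∑ v ∈ V, lam v • v = y
  · simp [hxy]
  obtain ⟨κ, u, w, hκ, hu, hw, h, hdist⟩ := exists_transport hlam hsum hy hxy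
  have h1 : inner ℝ g u ≤ A :=
    convexHull_min (t := {z | inner ℝ g z ≤ A}) (fun v hv => hA v hv.1 hv.2)
      (convex_halfSpace_le (innerSL ℝ g).toLinearMap.isLinear A) hu
  have h2 : ∀ z ∈ convexHull ℝ (V : Set (Vec d)), B ≤ inner ℝ g z := fun z hz =>
    convexHull_min (t := {z | B ≤ inner ℝ g z}) (fun v hv => hB v hv)
      (convex_halfSpace_ge (innerSL ℝ g).toLinearMap.isLinear B) hz
  have h3 := h2 w hw
  have h4 := h2 u (convexHull_mono (fun v hv => hv.1) hu)
  -- The inner product is `κ ⟨g, u - w⟩ ≤ κ (A - B)`, while `‖x - y‖ = κ ‖u - w‖` is at least `κ`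
  -- times the facial distance.
  rw [h, real_inner_smul_right, inner_sub_right, norm_smul, Real.norm_of_nonneg hκ.le]
  have h5 : facialDistance V * (κ * (inner ℝ g u - inner ℝ g w))
      ≤ facialDistance V * (κ * (A - B)) :=
    mul_le_mul_of_nonneg_left (mul_le_mul_of_nonneg_left (by linarith) hκ.le)
      (facialDistance_nonneg V)
  have h6 : facialDistance V * (κ * (A - B)) ≤ ‖u - w‖ * (κ * (A - B)) :=
    mul_le_mul_of_nonneg_right hdist (mul_nonneg hκ.le (by linarith))
  linarith

end FacialDistance

end PolyGame

namespace PolyGame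

/-! ### One step of away-step Frank-Wolfe. -/

section AwayStepFrankWolfe

variable {d : ℕ} {V : Finset (Vec d)}

/-- `f` is `1`-strongly convex and `L`-smooth on `X`, with gradient `gradf`. -/
structure IsSmoothStrong (X : Set (Vec d)) (f : Vec d → ℝ) (gradf : Vec d → Vec d) (L : ℝ) :
    Prop where
  lower : ∀ x ∈ X, ∀ y ∈ X, f x + inner ℝ (gradf x) (y - x) + 1 / 2 * ‖y - x‖ ^ 2 ≤ f y
  upper : ∀ x ∈ X, ∀ y ∈ X, f y ≤ f x + inner ℝ (gradf x) (y - x) + L / 2 * ‖y - x‖ ^ 2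

/-- The active atoms of the state carry positive weights that represent its point. -/
structure AFWState.Valid (V : Finset (Vec d)) (σ : AFWState d) : Prop where
  subset : σ.active ⊆ V
  pos : ∀ v ∈ σ.active, 0 < σ.weight v
  zero : ∀ v, v ∉ σ.active → σ.weight v = 0
  sum : ∑ v ∈ V, σ.weight v = 1
  pt_eq : σ.pt = ∑ v ∈ V, σ.weight v • v

namespace AFWState.Valid

variable {σ : AFWState d}

lemma nonneg (h : σ.Valid V) (v : Vec d) : 0 ≤ σ.weight v := by
  by_cases hv : v ∈ σ.active
  · exact (h.pos v hv).le
  · exact (h.zero v hv).ge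

lemma mem_active (h : σ.Valid V) {v : Vec d} (hv : 0 < σ.weight v) : v ∈ σ.active := by
  by_contra hn
  exact hv.ne' (h.zero v hn)

lemma pt_mem (h : σ.Valid V) : σ.pt ∈ convexHull ℝ (V : Set (Vec d)) := by
  rw [h.pt_eq]
  exact (convex_convexHull ℝ _).sum_mem (fun v _ => h.nonneg v) h.sum
    fun v hv => subset_convexHull ℝ _ hv

lemma active_nonempty (h : σ.Valid V) : σ.active.Nonempty := by
  by_contra hn
  rw [Finset.not_nonempty_iff_eq_empty] at hn
  have : ∑ v ∈ V, σ.weight v = 0 := Finset.sum_eq_zero fun v _ => h.zero v (by simp [hn])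
  linarith [h.sum]

lemma weight_le_one (h : σ.Valid V) {a : Vec d} (ha : a ∈ V) : σ.weight a ≤ 1 :=
  h.sum ▸ Finset.single_le_sum (fun v _ => h.nonneg v) ha

lemma pt_eq_of_weight_eq_one (h : σ.Valid V) {a : Vec d} (ha : a ∈ V) (h1 : σ.weight a = 1) :
    σ.pt = a := by
  classical
  have hs := h.sum
  rw [← Finset.add_sum_erase V _ ha, h1] at hs
  have hz := (Finset.sum_eq_zero_iff_of_nonneg fun v _ => h.nonneg v).1
    (by linarith : ∑ v ∈ V.erase a, σ.weight v = 0)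
  rw [h.pt_eq, ← Finset.add_sum_erase V _ ha, h1, one_smul, Finset.sum_eq_zero, add_zero]
  intro v hv
  rw [hz v hv, zero_smul]

-- A full step `γ = 1` annihilates all old weights, in agreement with the active set `{s}`.
open Classical in
lemma frankWolfe (h : σ.Valid V) {s : Vec d} (hs : s ∈ V) {γ : ℝ} (h0 : 0 < γ) (h1 : γ ≤ 1) :
    AFWState.Valid V
      { pt := σ.pt + γ • (s - σ.pt)
        active := if γ = 1 then {s} else insert s σ.active
        weight := fun v => (1 - γ) * σ.weight v + if v = s then γ else 0 } where
  subset := by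
    dsimp only
    split_ifs
    · simpa using hs
    · exact Finset.insert_subset hs h.subset
  pos := by
    dsimp only
    intro v hv
    by_cases hγ : γ = 1
    · rw [if_pos hγ, Finset.mem_singleton] at hv
      rw [if_pos hv, hγ]; norm_num
    · rw [if_neg hγ, Finset.mem_insert] at hv
      have h2 : 0 < 1 - γ := sub_pos.2 (h1.lt_of_ne hγ)
      have h3 := mul_nonneg h2.le (h.nonneg v)
      split_ifs with hvs
      · linarith
      · have := mul_pos h2 (h.pos v (hv.resolve_left hvs))
        linarith
  zero := by
    dsimp only
    intro v hv
    by_cases hγ : γ = 1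
    · rw [if_pos hγ, Finset.mem_singleton] at hv
      rw [if_neg hv, hγ]; simp
    · rw [if_neg hγ, Finset.mem_insert, not_or] at hv
      rw [if_neg hv.1, h.zero v hv.2]; simp
  sum := by
    dsimp only
    rw [Finset.sum_add_distrib, ← Finset.mul_sum, h.sum, Finset.sum_ite_eq' V s, if_pos hs]
    ring
  pt_eq := by
    dsimp only
    simp only [add_smul, mul_smul, Finset.sum_add_distrib, ← Finset.smul_sum, ← h.pt_eq, ite_smul,
      zero_smul]
    rw [Finset.sum_ite_eq' V s (fun v => γ • v), if_pos hs]
    module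

-- The new weight of `a` is `(1 + γ) λ - γ`, with `λ` the old one; it vanishes exactly at the
-- maximal step.
open Classical in
lemma awayStep (h : σ.Valid V) {a : Vec d} (ha : a ∈ σ.active) (ha1 : σ.weight a < 1) {γ : ℝ}
    (h0 : 0 < γ) (h1 : γ ≤ σ.weight a / (1 - σ.weight a)) :
    AFWState.Valid V
      { pt := σ.pt + γ • (σ.pt - a)
        active := if γ = σ.weight a / (1 - σ.weight a) then σ.active.erase a else σ.active
        weight := fun v => (1 + γ) * σ.weight v - if v = a then γ else 0 } where
  subset := by
    dsimp only
    split_ifs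
    · exact (Finset.erase_subset _ _).trans h.subset
    · exact h.subset
  pos := by
    dsimp only
    intro v hv
    have hγ : 0 < 1 + γ := by linarith
    by_cases hva : v = a
    · subst hva
      have hne : γ ≠ σ.weight v / (1 - σ.weight v) := by
        intro he
        rw [if_pos he] at hv
        simp at hv
      have := h1.lt_of_ne hne
      rw [lt_div_iff₀ (by linarith)] at this
      rw [if_pos rfl]
      linarith
    · rw [if_neg hva]
      have hv' : v ∈ σ.active := by
        split_ifs at hv
        · exact Finset.mem_of_mem_erase hv
        · exact hv
      have := mul_pos hγ (h.pos v hv')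
      linarith
  zero := by
    dsimp only
    intro v hv
    by_cases hva : v = a
    · subst hva
      have he : γ = σ.weight v / (1 - σ.weight v) := by
        by_contra hne
        rw [if_neg hne] at hv
        exact hv ha
      rw [eq_div_iff (by linarith)] at he
      rw [if_pos rfl]
      linarith
    · rw [if_neg hva]
      have hv' : v ∉ σ.active := by
        split_ifs at hv
        · exact fun hm => hv (Finset.mem_erase.2 ⟨hva, hm⟩)
        · exact hv
      rw [h.zero v hv']; simp
  sum := by
    dsimp only
    rw [Finset.sum_sub_distrib, ← Finset.mul_sum, h.sum, Finset.sum_ite_eq' V a,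
      if_pos (h.subset ha)]
    ring
  pt_eq := by
    dsimp only
    simp only [sub_smul, mul_smul, Finset.sum_sub_distrib, ← Finset.smul_sum, ← h.pt_eq, ite_smul,
      zero_smul]
    rw [Finset.sum_ite_eq' V a (fun v => γ • v), if_pos (h.subset ha)]
    module

end AFWState.Valid

lemma afwInit_valid {v₀ : Vec d} (hv : v₀ ∈ V) : (afwInit v₀).Valid V where
  subset := by simpa [afwInit] using hv
  pos := by simp [afwInit]
  zero := by simp [afwInit]
  sum := by simp [afwInit, hv]
  pt_eq := by simp [afwInit, hv]

section Steps

variable {f : Vec d → ℝ} {gradf : Vec d → Vec d} {L : ℝ}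
  {lmo : Vec d → Vec d} {away : Finset (Vec d) → Vec d → Vec d} {σ : AFWState d}

/-- Descent along a direction with a short step. -/
lemma IsSmoothStrong.descent {X : Set (Vec d)} (hf : IsSmoothStrong X f gradf L) (hL : 0 < L)
    {x v : Vec d} {γ γm : ℝ} (hx : x ∈ X) (hγ : γ = min (inner ℝ (-gradf x) v / (L * ‖v‖ ^ 2)) γm)
    (hγ0 : 0 ≤ γ) (hxv : x + γ • v ∈ X) (hv : 0 < ‖v‖) :
    f (x + γ • v) ≤ f x - γ * inner ℝ (-gradf x) v / 2 := by
  have h := hf.upper x hx _ hxv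
  rw [add_sub_cancel_left, real_inner_smul_right, norm_smul, Real.norm_of_nonneg hγ0] at h
  have h1 : γ ≤ inner ℝ (-gradf x) v / (L * ‖v‖ ^ 2) := hγ ▸ min_le_left _ _
  rw [le_div_iff₀ (by positivity)] at h1
  have h2 := mul_le_mul_of_nonneg_left h1 hγ0
  rw [inner_neg_left] at h2 ⊢
  nlinarith

lemma inner_sub_le_wolfeGap (hlmo : IsLMO V lmo) {x y : Vec d}
    (hy : y ∈ convexHull ℝ (V : Set (Vec d))) :
    inner ℝ (gradf x) (x - y) ≤ wolfeGap lmo gradf x := by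
  have h : inner ℝ (gradf x) (lmo (gradf x)) ≤ inner ℝ (gradf x) y :=
    convexHull_min (t := {z | inner ℝ (gradf x) (lmo (gradf x)) ≤ inner ℝ (gradf x) z})
      (fun v hv => (hlmo (gradf x)).2 v hv)
      (convex_halfSpace_ge (innerSL ℝ (gradf x)).toLinearMap.isLinear _) hy
  rw [wolfeGap, inner_neg_left, inner_sub_right, inner_sub_right]
  linarith

/-- The primal gap is bounded by the squared pairwise gap. -/
lemma two_mul_sq_mul_primal_le (hf : IsSmoothStrong (convexHull ℝ (V : Set (Vec d))) f gradf L)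
    (hlmo : IsLMO V lmo) (haway : IsAwayOracle away) (hσ : σ.Valid V) {y : Vec d}
    (hy : y ∈ convexHull ℝ (V : Set (Vec d))) :
    2 * facialDistance V ^ 2 * (f σ.pt - f y) ≤
      (inner ℝ (gradf σ.pt) (away σ.active (gradf σ.pt) - lmo (gradf σ.pt))) ^ 2 := by
  set g := gradf σ.pt
  have h1 := facialDistance_mul_inner_le (V := V) (lam := σ.weight) (fun v _ => hσ.nonneg v)
    hσ.sum hy (g := g) (fun v _ hv => (haway σ.active g hσ.active_nonempty).2 v (hσ.mem_active hv))
    (fun v hv => (hlmo g).2 v hv)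
  rw [← hσ.pt_eq, ← inner_sub_right] at h1
  have h2 := hf.lower σ.pt hσ.pt_mem y hy
  have h3 : inner ℝ (gradf σ.pt) (y - σ.pt) = -inner ℝ g (σ.pt - y) := by
    rw [← inner_neg_right, neg_sub]
  rw [h3, norm_sub_rev] at h2
  have hδ := facialDistance_nonneg V
  set δ := facialDistance V
  set G : ℝ := inner ℝ g (away σ.active g - lmo g)
  have h4 := mul_le_mul_of_nonneg_left h2 (by positivity : 0 ≤ 2 * δ ^ 2)
  have h5 := mul_le_mul_of_nonneg_left h1 (by positivity : 0 ≤ 2 * δ)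
  -- With `r = ‖x - y‖`, maximize `G r/δ - r²/2`; the maximum is at `r = G/δ`.
  nlinarith [sq_nonneg (G - δ * ‖σ.pt - y‖)]

/-- Each step of away-step Frank-Wolfe either makes progress or drops an active atom. -/
lemma afwStep_spec (hf : IsSmoothStrong (convexHull ℝ (V : Set (Vec d))) f gradf L)
    (hL : 1 ≤ L) (hlmo : IsLMO V lmo) (haway : IsAwayOracle away) (hV : 1 < V.card)
    (hσ : σ.Valid V) {ε D : ℝ} (hε : 0 < ε) (hgap : ε < wolfeGap lmo gradf σ.pt)
    (hD : D = Metric.diam (convexHull ℝ (V : Set (Vec d)))) :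
    (afwStep lmo away gradf L σ).Valid V ∧
    (((∀ y ∈ convexHull ℝ (V : Set (Vec d)), f (afwStep lmo away gradf L σ).pt - f y ≤
          (1 - facialDistance V ^ 2 / (4 * L * D ^ 2)) * (f σ.pt - f y)) ∧
        f (afwStep lmo away gradf L σ).pt ≤ f σ.pt - min (ε ^ 2 / (2 * L * D ^ 2)) (ε / 2) ∧
        (afwStep lmo away gradf L σ).active.card ≤ σ.active.card + 1) ∨
      (f (afwStep lmo away gradf L σ).pt ≤ f σ.pt ∧
        (afwStep lmo away gradf L σ).active.card + 1 ≤ σ.active.card)) := by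
  classical
  have hδ := facialDistance_pos hV
  have hδD := facialDistance_le_diam hV
  rw [← hD] at hδD
  set δ := facialDistance V
  have hDpos : 0 < D := hδ.trans_le hδD
  have hL0 : 0 < L := by linarith
  have hdist : ∀ {x y : Vec d}, x ∈ convexHull ℝ (V : Set (Vec d)) →
      y ∈ convexHull ℝ (V : Set (Vec d)) → ‖x - y‖ ≤ D := fun hx hy => by
    rw [hD, ← dist_eq_norm]
    exact Metric.dist_le_diam_of_mem (isCompact_convexHull_finset V).isBounded hx hy
  have hxP := hσ.pt_mem
  obtain ⟨hsV, -⟩ := hlmo (gradf σ.pt)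
  obtain ⟨haS, -⟩ := haway σ.active (gradf σ.pt) hσ.active_nonempty
  have hprimal := fun y hy => two_mul_sq_mul_primal_le (y := y) hf hlmo haway hσ hy
  have hprimal' : ∀ y ∈ convexHull ℝ (V : Set (Vec d)),
      f σ.pt - f y ≤ wolfeGap lmo gradf σ.pt := fun y hy => by
    have h1 := hf.lower σ.pt hxP y hy
    have h2 := inner_sub_le_wolfeGap (gradf := gradf) hlmo (x := σ.pt) hy
    have h3 : inner ℝ (gradf σ.pt) (y - σ.pt) = -inner ℝ (gradf σ.pt) (σ.pt - y) := by
      rw [← inner_neg_right, neg_sub]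
    have h4 : 0 ≤ ‖y - σ.pt‖ ^ 2 := by positivity
    linarith
  rw [wolfeGap] at hgap hprimal'
  -- The pairwise gap is the sum of the Frank-Wolfe and away gaps, so the larger of them is at least
  -- half of it.
  have hsum : inner ℝ (gradf σ.pt) (away σ.active (gradf σ.pt) - lmo (gradf σ.pt))
      = inner ℝ (-gradf σ.pt) (lmo (gradf σ.pt) - σ.pt)
        + inner ℝ (-gradf σ.pt) (σ.pt - away σ.active (gradf σ.pt)) := by
    simp only [inner_neg_left, inner_sub_right]; ring
  rw [hsum] at hprimal
  -- progress of a step of Newton length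
  have hgood : ∀ q G : ℝ, 0 ≤ G → G ≤ 2 * q → ∀ h : ℝ, 2 * δ ^ 2 * h ≤ G ^ 2 →
      δ ^ 2 / (4 * L * D ^ 2) * h ≤ q ^ 2 / (2 * L * D ^ 2) := by
    intro q G hG hGq h hh
    have h1 : G ^ 2 ≤ (2 * q) ^ 2 := by gcongr
    rw [div_mul_eq_mul_div, div_le_div_iff₀ (by positivity) (by positivity)]
    have h2 : 0 ≤ L * D ^ 2 := by positivity
    nlinarith
  have hnewton : ∀ (v : Vec d), ε < inner ℝ (-gradf σ.pt) v → ‖v‖ ≤ D → 0 < ‖v‖ ∧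
      0 < inner ℝ (-gradf σ.pt) v / (L * ‖v‖ ^ 2) ∧
      inner ℝ (-gradf σ.pt) v ^ 2 / (2 * L * D ^ 2) ≤
        inner ℝ (-gradf σ.pt) v / (L * ‖v‖ ^ 2) * inner ℝ (-gradf σ.pt) v / 2 := by
    intro v hv hvD
    have hq : 0 < inner ℝ (-gradf σ.pt) v := hε.trans hv
    have hvn : 0 < ‖v‖ := by
      rw [norm_pos_iff]
      rintro rfl
      simp at hq
    refine ⟨hvn, by positivity, ?_⟩
    have e : inner ℝ (-gradf σ.pt) v / (L * ‖v‖ ^ 2) * inner ℝ (-gradf σ.pt) v / 2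
        = inner ℝ (-gradf σ.pt) v ^ 2 / (2 * L * ‖v‖ ^ 2) := by
      field_simp
    rw [e]
    gcongr
  unfold afwStep
  extract_lets g s a dFW dA γ γmax γ'
  change ε < inner ℝ (-g) dFW at hgap
  change ∀ y ∈ _, f σ.pt - f y ≤ inner ℝ (-g) dFW at hprimal'
  change ∀ y ∈ _, 2 * δ ^ 2 * (f σ.pt - f y) ≤ (inner ℝ (-g) dFW + inner ℝ (-g) dA) ^ 2 at hprimal
  have hsP := subset_convexHull ℝ (V : Set (Vec d)) hsV
  have haP := subset_convexHull ℝ (V : Set (Vec d)) (hσ.subset haS)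
  have hmono : ∀ q : ℝ, ε < q → ε ^ 2 / (2 * L * D ^ 2) ≤ q ^ 2 / (2 * L * D ^ 2) := by
    intro q hq
    gcongr
  by_cases hcase : inner ℝ (-g) dFW ≥ inner ℝ (-g) dA
  · rw [if_pos hcase]
    obtain ⟨hn, hpos, hdec⟩ := hnewton dFW hgap (hdist hsP hxP)
    have hγ0 : 0 < γ := lt_min hpos one_pos
    have hval := hσ.frankWolfe hsV hγ0 (min_le_right _ _)
    refine ⟨hval, Or.inl ?_⟩
    have hdesc := hf.descent hL0 (v := dFW) (γ := γ) hxP rfl hγ0.le hval.pt_mem hn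
    change f (σ.pt + γ • dFW) ≤ f σ.pt - γ * inner ℝ (-g) dFW / 2 at hdesc
    dsimp only
    refine ⟨fun y hy => ?_, ?_, ?_⟩
    · have h1 := hprimal y hy
      have h2 := hprimal' y hy
      rcases min_choice (inner ℝ (-g) dFW / (L * ‖dFW‖ ^ 2)) 1 with h | h
      · have hγe : γ = inner ℝ (-g) dFW / (L * ‖dFW‖ ^ 2) := h
        rw [hγe] at hdesc ⊢
        by_cases hG : 0 ≤ inner ℝ (-g) dFW + inner ℝ (-g) dA
        · have h3 := hgood (inner ℝ (-g) dFW) _ hG (by linarith) _ h1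
          linarith
        -- The away gap is nonnegative: the iterate is an average of active atoms.
        · exfalso
          have : inner ℝ (-g) dA = inner ℝ g a - inner ℝ g σ.pt := by
            simp only [dA, inner_neg_left, inner_sub_right]; ring
          have hax : inner ℝ g σ.pt ≤ inner ℝ g a := by
            conv_lhs => rw [hσ.pt_eq, inner_sum]
            calc ∑ v ∈ V, inner ℝ g (σ.weight v • v) ≤ ∑ v ∈ V, σ.weight v * inner ℝ g a := by
                  refine Finset.sum_le_sum fun v _ => ?_
                  rw [real_inner_smul_right]
                  by_cases hv : v ∈ σ.active
                  · exact mul_le_mul_of_nonneg_left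
                      ((haway σ.active g hσ.active_nonempty).2 v hv) (hσ.nonneg v)
                  · rw [hσ.zero v hv]; simp
              _ = inner ℝ g a := by rw [← Finset.sum_mul, hσ.sum, one_mul]
          linarith
      -- A full step gains half the Wolfe gap, hence half the primal gap; only a quarter is needed.
      · have hγe : γ = 1 := h
        rw [hγe] at hdesc ⊢
        have h3 : δ ^ 2 / (4 * L * D ^ 2) ≤ 1 / 4 := by
          rw [div_le_div_iff₀ (by positivity) (by positivity)]
          have : δ ^ 2 ≤ D ^ 2 := by gcongr
          nlinarith [sq_nonneg D]
        have h4 : 0 ≤ δ ^ 2 / (4 * L * D ^ 2) := by positivity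
        have h5 : δ ^ 2 / (4 * L * D ^ 2) * (f σ.pt - f y) ≤ inner ℝ (-g) dFW / 2 := by
          nlinarith
        linarith
    · rcases min_choice (inner ℝ (-g) dFW / (L * ‖dFW‖ ^ 2)) 1 with h | h
      · have hγe : γ = inner ℝ (-g) dFW / (L * ‖dFW‖ ^ 2) := h
        rw [hγe] at hdesc ⊢
        linarith [hmono _ hgap, min_le_left (ε ^ 2 / (2 * L * D ^ 2)) (ε / 2)]
      · have hγe : γ = 1 := h
        rw [hγe] at hdesc ⊢
        linarith [min_le_right (ε ^ 2 / (2 * L * D ^ 2)) (ε / 2)]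
    · split_ifs
      · simp
      · exact Finset.card_insert_le _ _
  · rw [if_neg hcase]
    have hgap' : ε < inner ℝ (-g) dA := hgap.trans (not_le.1 hcase)
    obtain ⟨hn, hpos, hdec⟩ := hnewton dA hgap' (hdist hxP haP)
    -- Weight `1` would put the iterate at `a` and make the away direction zero.
    have ha1 : σ.weight a < 1 := by
      refine (hσ.weight_le_one (hσ.subset haS)).lt_of_ne fun h => ?_
      have := hσ.pt_eq_of_weight_eq_one (hσ.subset haS) h
      have hz : dA = 0 := sub_eq_zero.2 this
      rw [hz, norm_zero] at hn
      exact lt_irrefl _ hn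
    have hγm : 0 < γmax := div_pos (hσ.pos a haS) (by linarith)
    have hγ0 : 0 < γ' := lt_min hpos hγm
    have hval := hσ.awayStep haS ha1 hγ0 (min_le_right _ _)
    refine ⟨hval, ?_⟩
    have hdesc := hf.descent hL0 (v := dA) (γ := γ') hxP rfl hγ0.le hval.pt_mem hn
    change f (σ.pt + γ' • dA) ≤ f σ.pt - γ' * inner ℝ (-g) dA / 2 at hdesc
    dsimp only
    by_cases hdrop : γ' = γmax
    · right
      rw [if_pos hdrop, Finset.card_erase_add_one haS]
      have : 0 ≤ γ' * inner ℝ (-g) dA / 2 := by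
        have := hε.trans hgap'
        positivity
      exact ⟨by linarith, le_rfl⟩
    · left
      rw [if_neg hdrop]
      have hγe : γ' = inner ℝ (-g) dA / (L * ‖dA‖ ^ 2) :=
        (min_choice _ _).resolve_right hdrop
      rw [hγe] at hdesc ⊢
      refine ⟨fun y hy => ?_, ?_, by omega⟩
      · have h3 := hgood (inner ℝ (-g) dA) _ (by linarith) (by linarith) _ (hprimal y hy)
        linarith
      · linarith [hmono _ hgap', min_le_left (ε ^ 2 / (2 * L * D ^ 2)) (ε / 2)]

end Steps

end AwayStepFrankWolfe

end PolyGame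

namespace PolyGame

/-! ### Iteration count and termination of away-step Frank-Wolfe. -/

section AwayStepFrankWolfe

variable {d : ℕ} {V : Finset (Vec d)} {f : Vec d → ℝ} {gradf : Vec d → Vec d} {L : ℝ}
  {lmo : Vec d → Vec d} {away : Finset (Vec d) → Vec d → Vec d} {v₀ : Vec d} {ε D : ℝ}

lemma afwState_succ (k : ℕ) : afwState lmo away gradf L v₀ (k + 1)
    = afwStep lmo away gradf L (afwState lmo away gradf L v₀ k) :=
  Function.iterate_succ_apply' _ _ _

lemma contraction_mem (hL : 1 ≤ L) (hV : 1 < V.card)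
    (hD : D = Metric.diam (convexHull ℝ (V : Set (Vec d)))) :
    0 < facialDistance V ^ 2 / (4 * L * D ^ 2) ∧ facialDistance V ^ 2 / (4 * L * D ^ 2) ≤ 1 := by
  have hδ := facialDistance_pos hV
  have hδD := facialDistance_le_diam hV
  rw [← hD] at hδD
  have hDpos : 0 < D := hδ.trans_le hδD
  refine ⟨by positivity, ?_⟩
  rw [div_le_one (by positivity)]
  have : facialDistance V ^ 2 ≤ D ^ 2 := by gcongr
  nlinarith [sq_nonneg D]

/-- Before termination, at least half of the steps of away-step Frank-Wolfe make progress. -/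
lemma afwState_progress (hf : IsSmoothStrong (convexHull ℝ (V : Set (Vec d))) f gradf L)
    (hL : 1 ≤ L) (hlmo : IsLMO V lmo) (haway : IsAwayOracle away) (hV : 1 < V.card)
    (hv₀ : v₀ ∈ V) (hε : 0 < ε) (hD : D = Metric.diam (convexHull ℝ (V : Set (Vec d)))) (k : ℕ)
    (hgap : ∀ j < k, ε < wolfeGap lmo gradf (afwState lmo away gradf L v₀ j).pt) :
    (afwState lmo away gradf L v₀ k).Valid V ∧
    ∃ m : ℕ, k + (afwState lmo away gradf L v₀ k).active.card ≤ 2 * m + 1 ∧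
      (∀ y ∈ convexHull ℝ (V : Set (Vec d)), f (afwState lmo away gradf L v₀ k).pt - f y ≤
        (1 - facialDistance V ^ 2 / (4 * L * D ^ 2)) ^ m * (f v₀ - f y)) ∧
      (m = 0 ∨ ∀ y ∈ convexHull ℝ (V : Set (Vec d)), f y ≤ f (afwState lmo away gradf L v₀ k).pt →
        min (ε ^ 2 / (2 * L * D ^ 2)) (ε / 2) ≤
          (1 - facialDistance V ^ 2 / (4 * L * D ^ 2)) ^ (m - 1) * (f v₀ - f y)) := by
  induction k with
  | zero =>
    refine ⟨afwInit_valid hv₀, 0, ?_, ?_, Or.inl rfl⟩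
    · simp [afwState, afwInit]
    · simp [afwState, afwInit]
  | succ k ih =>
    obtain ⟨hval, m, hcard, hcontr, hprog⟩ := ih fun j hj => hgap j (by omega)
    have hstep := afwStep_spec hf hL hlmo haway hV hval hε (hgap k (by omega)) hD
    obtain ⟨hρ0, hρ1⟩ := contraction_mem hL hV hD
    rw [← afwState_succ] at hstep
    obtain ⟨hval', ⟨h1, h2, h3⟩ | ⟨h1, h2⟩⟩ := hstep
    -- A progress step raises `k + card` by at most `2`, a drop step does not raise it; it starts at
    -- `1`.
    · refine ⟨hval', m + 1, by omega, fun y hy => ?_, Or.inr fun y hy hle => ?_⟩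
      · refine (h1 y hy).trans
          ((mul_le_mul_of_nonneg_left (hcontr y hy) (sub_nonneg.2 hρ1)).trans_eq ?_)
        ring
      -- The fixed decrease of this step cannot exceed the primal gap before it.
      · rw [Nat.add_sub_cancel]
        linarith [hcontr y hy]
    · refine ⟨hval', m, by omega, fun y hy => ?_, hprog.imp_right fun hp y hy hle => ?_⟩
      · linarith [hcontr y hy]
      · exact hp y hy (hle.trans h1)

/-- The last progress step still lowers `f` by the minimum `μ`, so `μ ≤ (1 - ρ)^(m - 1) H`, which
forces `ρ (m - 1) ≤ Λ`, while `k ≤ 2 m`. The comparison point is the current iterate, so no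
minimizer is needed. -/
lemma afwState_iterations_le (hf : IsSmoothStrong (convexHull ℝ (V : Set (Vec d))) f gradf L)
    (hL : 1 ≤ L) (hlmo : IsLMO V lmo) (haway : IsAwayOracle away) (hV : 1 < V.card)
    (hv₀ : v₀ ∈ V) (hε : 0 < ε) (hD : D = Metric.diam (convexHull ℝ (V : Set (Vec d))))
    {H Λ : ℝ} (hH : ∀ y ∈ convexHull ℝ (V : Set (Vec d)), f v₀ - f y ≤ H) (hΛ : 0 ≤ Λ)
    (hHΛ : H ≤ min (ε ^ 2 / (2 * L * D ^ 2)) (ε / 2) * Real.exp Λ) {k : ℕ}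
    (hgap : ∀ j < k, ε < wolfeGap lmo gradf (afwState lmo away gradf L v₀ j).pt) :
    (k : ℝ) ≤ 2 + 8 * (L * D ^ 2 / facialDistance V ^ 2) * Λ := by
  obtain ⟨hval, m, hcard, -, hprog⟩ :=
    afwState_progress hf hL hlmo haway hV hv₀ hε hD k hgap
  obtain ⟨hρ0, hρ1⟩ := contraction_mem hL hV hD
  have hδ := facialDistance_pos hV
  have hδD := facialDistance_le_diam hV
  rw [← hD] at hδD
  have hDpos : 0 < D := hδ.trans_le hδD
  have hcpos := hval.active_nonempty.card_pos
  have hk : k ≤ 2 * m := by omega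
  have hkr : (k : ℝ) ≤ 2 * m := by exact_mod_cast hk
  have hnn : 0 ≤ 8 * (L * D ^ 2 / facialDistance V ^ 2) * Λ := by positivity
  rcases hprog with rfl | hp
  · simp only [Nat.cast_zero, mul_zero] at hkr
    linarith
  · set ρ := facialDistance V ^ 2 / (4 * L * D ^ 2) with hρ
    set μ := min (ε ^ 2 / (2 * L * D ^ 2)) (ε / 2)
    have hμ : 0 < μ := lt_min (by positivity) (by positivity)
    have h1 := hp _ hval.pt_mem le_rfl
    have h2 : (1 - ρ) ^ (m - 1) ≤ Real.exp (-(ρ * ((m - 1 : ℕ) : ℝ))) := by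
      rw [show -(ρ * ((m - 1 : ℕ) : ℝ)) = ((m - 1 : ℕ) : ℝ) * (-ρ) by ring, Real.exp_nat_mul]
      gcongr
      linarith [Real.add_one_le_exp (-ρ)]
    have h3 : μ ≤ Real.exp (-(ρ * ((m - 1 : ℕ) : ℝ))) * (μ * Real.exp Λ) := by
      have hH0 := (hH _ hval.pt_mem).trans hHΛ
      refine h1.trans ((mul_le_mul_of_nonneg_left hH0 (pow_nonneg (by linarith) _)).trans ?_)
      gcongr
    have h4 : 1 ≤ Real.exp (-(ρ * ((m - 1 : ℕ) : ℝ)) + Λ) := by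
      rw [Real.exp_add]
      by_contra! h
      nlinarith
    have h5 : ρ * ((m - 1 : ℕ) : ℝ) ≤ Λ := by
      have := Real.one_le_exp_iff.1 h4
      linarith
    have h6 : (m : ℝ) - 1 ≤ ((m - 1 : ℕ) : ℝ) := by
      rcases m with _ | m <;> simp
    have h7 : ((m - 1 : ℕ) : ℝ) ≤ Λ / ρ := by
      rw [le_div_iff₀ hρ0]; linarith
    have h8 : Λ / ρ = 4 * (L * D ^ 2 / facialDistance V ^ 2) * Λ := by
      rw [hρ]; field_simp
    linarith

/-- Away-step Frank-Wolfe terminates. -/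
lemma afwHalts_of_smoothStrong (hf : IsSmoothStrong (convexHull ℝ (V : Set (Vec d))) f gradf L)
    (hL : 1 ≤ L) (hlmo : IsLMO V lmo) (haway : IsAwayOracle away) (hV : 1 < V.card)
    (hv₀ : v₀ ∈ V) (hε : 0 < ε) {H : ℝ}
    (hH : ∀ y ∈ convexHull ℝ (V : Set (Vec d)), f v₀ - f y ≤ H) :
    AFWHalts lmo away gradf L v₀ ε := by
  by_contra hn
  simp only [AFWHalts, not_exists, not_le] at hn
  obtain ⟨D, hD⟩ : ∃ D, D = Metric.diam (convexHull ℝ (V : Set (Vec d))) := ⟨_, rfl⟩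
  have hDpos : 0 < D := hD ▸ (facialDistance_pos hV).trans_le (facialDistance_le_diam hV)
  set μ := min (ε ^ 2 / (2 * L * D ^ 2)) (ε / 2) with hμ
  have hμpos : 0 < μ := lt_min (by positivity) (by positivity)
  have hHΛ : H ≤ μ * Real.exp (|H| / μ) := by
    have h1 := mul_le_mul_of_nonneg_left (Real.add_one_le_exp (|H| / μ)) hμpos.le
    rw [mul_add, mul_div_cancel₀ _ hμpos.ne'] at h1
    linarith [le_abs_self H]
  obtain ⟨k, hk⟩ := exists_nat_gt (2 + 8 * (L * D ^ 2 / facialDistance V ^ 2) * (|H| / μ))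
  exact absurd (afwState_iterations_le hf hL hlmo haway hV hv₀ hε hD hH (by positivity) hHΛ
    (k := k) fun j _ => hn j) (not_le.2 hk)

lemma lt_wolfeGap_of_lt_afwStop {j : ℕ} (hj : j < afwStop lmo away gradf L v₀ ε) :
    ε < wolfeGap lmo gradf (afwState lmo away gradf L v₀ j).pt := by
  have := Nat.notMem_of_lt_sInf hj
  simpa using this

lemma wolfeGap_afwOutput_le (h : AFWHalts lmo away gradf L v₀ ε) :
    wolfeGap lmo gradf (afwOutput lmo away gradf L v₀ ε) ≤ ε :=
  Nat.sInf_mem h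

lemma afwOutput_mem (hf : IsSmoothStrong (convexHull ℝ (V : Set (Vec d))) f gradf L)
    (hL : 1 ≤ L) (hlmo : IsLMO V lmo) (haway : IsAwayOracle away) (hV : 1 < V.card)
    (hv₀ : v₀ ∈ V) (hε : 0 < ε) :
    afwOutput lmo away gradf L v₀ ε ∈ convexHull ℝ (V : Set (Vec d)) :=
  (afwState_progress hf hL hlmo haway hV hv₀ hε rfl _
    fun _ hj => lt_wolfeGap_of_lt_afwStop hj).1.pt_mem

lemma afwCalls_le (hf : IsSmoothStrong (convexHull ℝ (V : Set (Vec d))) f gradf L)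
    (hL : 1 ≤ L) (hlmo : IsLMO V lmo) (haway : IsAwayOracle away) (hV : 1 < V.card)
    (hv₀ : v₀ ∈ V) (hε : 0 < ε) (hD : D = Metric.diam (convexHull ℝ (V : Set (Vec d))))
    {H Λ : ℝ} (hH : ∀ y ∈ convexHull ℝ (V : Set (Vec d)), f v₀ - f y ≤ H) (hΛ : 0 ≤ Λ)
    (hHΛ : H ≤ min (ε ^ 2 / (2 * L * D ^ 2)) (ε / 2) * Real.exp Λ) :
    (afwCalls lmo away gradf L v₀ ε : ℝ) ≤ 3 + 8 * (L * D ^ 2 / facialDistance V ^ 2) * Λ := by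
  have h := afwState_iterations_le hf hL hlmo haway hV hv₀ hε hD hH hΛ hHΛ
    (k := afwStop lmo away gradf L v₀ ε) fun _ hj => lt_wolfeGap_of_lt_afwStop hj
  rw [afwCalls]
  push_cast
  linarith

/-- A singleton needs separate treatment: its facial distance is a default value and `L` is not
forced to be at least `1`. -/
lemma afwStop_of_card_eq_one (hlmo : IsLMO V lmo) (hV : V.card = 1) (hv₀ : v₀ ∈ V) (hε : 0 ≤ ε) :
    AFWHalts lmo away gradf L v₀ ε ∧ afwOutput lmo away gradf L v₀ ε = v₀ := by
  obtain ⟨v, rfl⟩ := Finset.card_eq_one.1 hV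
  obtain rfl := Finset.mem_singleton.1 hv₀
  have h0 : wolfeGap lmo gradf (afwState lmo away gradf L v₀ 0).pt ≤ ε := by
    have hl : ∀ g, lmo g = v₀ := fun g => Finset.mem_singleton.1 (hlmo g).1
    simpa [wolfeGap, hl, afwState, afwInit] using hε
  have hs : afwStop lmo away gradf L v₀ ε = 0 := Nat.sInf_eq_zero.2 (Or.inl h0)
  refine ⟨⟨0, h0⟩, ?_⟩
  rw [afwOutput, hs]
  rfl

end AwayStepFrankWolfe

/-! ### Away-step Frank-Wolfe on the proximal objectives. -/

namespace Game

variable {N : ℕ} {G : Game N} {R : ∀ i, Regularizer (G.X i)} {η : ℝ} {ε : Fin N → ℕ → ℝ}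
  {O : G.Oracles} {T : ℕ} {x : ℕ → G.Profile}

/-- The proximal objective of player `i` in round `t`, up to an additive constant. -/
noncomputable def proxObj (R : ∀ i, Regularizer (G.X i)) (η : ℝ) (x : ℕ → G.Profile) (i : Fin N)
    (t : ℕ) (z : Vec (G.n i)) : ℝ :=
  inner ℝ (η • G.stepVec x i t - (R i).grad (x (t - 1) i)) z + (R i).toFun z

/-- Adding a linear function leaves the Bregman divergence unchanged. -/
lemma proxObj_smoothStrong (i : Fin N) (t : ℕ) :
    IsSmoothStrong (convexHull ℝ (G.V i : Set (Vec (G.n i)))) (G.proxObj R η x i t)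
      (G.proxGrad R η x i t) (R i).L := by
  have key : ∀ z y : Vec (G.n i), G.proxObj R η x i t y
      = G.proxObj R η x i t z + inner ℝ (G.proxGrad R η x i t z) (y - z) + (R i).breg y z := by
    intro z y
    unfold proxObj proxGrad Regularizer.breg
    simp only [inner_sub_left, inner_add_left, inner_sub_right]
    ring
  refine ⟨fun z hz y hy => ?_, fun z hz y hy => ?_⟩
  · rw [key z y]
    linarith [(R i).half_sq_le_breg hz hy]
  · rw [key z y]
    linarith [(R i).breg_le_half_mul_sq hz hy]

lemma one_le_L (R : ∀ i, Regularizer (G.X i)) {i : Fin N} (hV : 1 < (G.V i).card) :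
    1 ≤ (R i).L := by
  obtain ⟨a, ha, b, hb, hab⟩ := Finset.one_lt_card.1 hV
  exact (R i).one_le_L (subset_convexHull ℝ _ ha) (subset_convexHull ℝ _ hb) hab

lemma proxObj_sub_le (i : Fin N) (t : ℕ) {z y : Vec (G.n i)} (hz : z ∈ G.X i) (hy : y ∈ G.X i) :
    G.proxObj R η x i t z - G.proxObj R η x i t y
      ≤ ‖G.proxGrad R η x i t z‖ * Metric.diam (G.X i) := by
  have h := (proxObj_smoothStrong (R := R) (η := η) (x := x) i t).lower z hz y hy
  have h1 := (abs_le.1 (abs_real_inner_le_norm (G.proxGrad R η x i t z) (y - z))).1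
  have h2 : ‖y - z‖ ≤ Metric.diam (G.X i) := by
    rw [← dist_eq_norm]
    exact Metric.dist_le_diam_of_mem (G.isCompact_X i).isBounded hy hz
  have h3 := mul_le_mul_of_nonneg_left h2 (norm_nonneg (G.proxGrad R η x i t z))
  nlinarith [sq_nonneg ‖y - z‖]

lemma haltsAt (hε : ∀ i, ∀ t ∈ Finset.Icc 1 T, 0 < ε i t) (i : Fin N) {t : ℕ}
    (ht : t ∈ Finset.Icc 1 T) : G.HaltsAt R η ε O x i t := by
  rcases (Nat.one_le_iff_ne_zero.2 (Finset.card_ne_zero.2 (G.nonempty i))).eq_or_lt with h | h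
  · exact (afwStop_of_card_eq_one (O.isLMO i) h.symm (O.start_mem i t) (hε i t ht).le).1
  · exact afwHalts_of_smoothStrong (proxObj_smoothStrong i t) (one_le_L R h) (O.isLMO i)
      (O.isAway i) h (O.start_mem i t) (hε i t ht)
      (fun y hy => proxObj_sub_le i t (subset_convexHull ℝ _ (O.start_mem i t)) hy)

lemma IsAFWRun.isGapRun (hε : ∀ i, ∀ t ∈ Finset.Icc 1 T, 0 < ε i t)
    (h : G.IsAFWRun R η ε O T x) : G.IsGapRun R η ε T x := by
  refine ⟨fun t ht i => ?_, fun t ht i u hu => ?_⟩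
  · rcases Nat.eq_zero_or_pos t with rfl | ht0
    · exact h.1 i
    · have htm : t ∈ Finset.Icc 1 T := Finset.mem_Icc.2 ⟨ht0, ht⟩
      rw [h.2 t htm i]
      rcases (Nat.one_le_iff_ne_zero.2 (Finset.card_ne_zero.2 (G.nonempty i))).eq_or_lt with hc | hc
      · rw [(afwStop_of_card_eq_one (O.isLMO i) hc.symm (O.start_mem i t) (hε i t htm).le).2]
        exact subset_convexHull ℝ _ (O.start_mem i t)
      · exact afwOutput_mem (proxObj_smoothStrong i t) (one_le_L R hc) (O.isLMO i)
          (O.isAway i) hc (O.start_mem i t) (hε i t htm)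
  · have hh := haltsAt (R := R) (η := η) (O := O) (x := x) hε i ht
    rw [h.2 t ht i]
    exact (inner_sub_le_wolfeGap (O.isLMO i) hu).trans (wolfeGap_afwOutput_le hh)

lemma norm_proxGrad_le (hG : G.Normalized) (hη0 : 0 ≤ η) (hη1 : η ≤ 1) {i : Fin N}
    (hV : 1 < (G.V i).card) {t : ℕ} (ht : 1 ≤ t) (hx : ∀ s < t, ∀ i, x s i ∈ G.X i)
    {z : Vec (G.n i)} (hz : z ∈ G.X i) :
    ‖G.proxGrad R η x i t z‖ ≤ 3 + (R i).L * Metric.diam (G.X i) := by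
  have h1 := norm_stepVec_le_three hG ht hx i
  have hy := hx (t - 1) (by omega) i
  have h2 := (R i).smooth z hz _ hy
  have h3 : ‖z - x (t - 1) i‖ ≤ Metric.diam (G.X i) := by
    rw [← dist_eq_norm]
    exact Metric.dist_le_diam_of_mem (G.isCompact_X i).isBounded hz hy
  have h4 := mul_le_mul_of_nonneg_left h3 (zero_le_one.trans (one_le_L R hV))
  have h5 : ‖η • G.stepVec x i t‖ ≤ 3 := by
    rw [norm_smul, Real.norm_of_nonneg hη0]
    nlinarith [norm_nonneg (G.stepVec x i t)]
  rw [proxGrad, add_sub_assoc]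
  exact (norm_add_le _ _).trans (by linarith)

/-- Number of LMO calls of player `i` in round `t`. -/
lemma callsAt_le (hG : G.Normalized) (hη0 : 0 ≤ η) (hη1 : η ≤ 1) {i : Fin N}
    (hV : 1 < (G.V i).card) {t : ℕ} (ht : 1 ≤ t) (hx : ∀ s < t, ∀ i, x s i ∈ G.X i)
    (hε : 0 < ε i t) {Λ : ℝ} (hΛ : 0 ≤ Λ)
    (hHΛ : (3 + (R i).L * Metric.diam (G.X i)) * Metric.diam (G.X i)
      ≤ min (ε i t ^ 2 / (2 * (R i).L * Metric.diam (G.X i) ^ 2)) (ε i t / 2) * Real.exp Λ) :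
    (G.callsAt R η ε O x i t : ℝ) ≤
      3 + 8 * ((R i).L * Metric.diam (G.X i) ^ 2 / facialDistance (G.V i) ^ 2) * Λ := by
  have hv := subset_convexHull ℝ (G.V i : Set (Vec (G.n i))) (O.start_mem i t)
  refine afwCalls_le (proxObj_smoothStrong i t) (one_le_L R hV) (O.isLMO i) (O.isAway i) hV
    (O.start_mem i t) hε rfl (fun y hy => ?_) hΛ hHΛ
  exact (proxObj_sub_le i t hv hy).trans (mul_le_mul_of_nonneg_right
    (norm_proxGrad_le hG hη0 hη1 hV ht hx hv) Metric.diam_nonneg)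

end Game

end PolyGame

namespace PolyGame

/-! ### Numerical estimates. -/

section Numerics

lemma sum_Icc_one_div_sq_le_two (T : ℕ) : ∑ t ∈ Finset.Icc 1 T, 1 / (t : ℝ) ^ 2 ≤ 2 := by
  have key : ∀ n : ℕ, ∑ t ∈ Finset.Icc 1 (n + 1), 1 / (t : ℝ) ^ 2 ≤ 2 - 1 / ((n : ℝ) + 1) := by
    intro n
    induction n with
    | zero => norm_num
    | succ n ih =>
      rw [Finset.sum_Icc_succ_top (by omega)]
      push_cast
      have h : 1 / ((n : ℝ) + 1 + 1) ^ 2 ≤ 1 / ((n : ℝ) + 1) - 1 / ((n : ℝ) + 1 + 1) := by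
        rw [div_sub_div _ _ (by positivity) (by positivity),
          div_le_div_iff₀ (by positivity) (by positivity)]
        nlinarith [(Nat.cast_nonneg n : (0 : ℝ) ≤ n)]
      linarith
  rcases T with _ | n
  · simp
  · have : 0 < 1 / ((n : ℝ) + 1) := by positivity
    linarith [key n]

lemma sum_Icc_one_div_le_one_add_log (T : ℕ) :
    ∑ t ∈ Finset.Icc 1 T, 1 / (t : ℝ) ≤ 1 + Real.log T := by
  have h := harmonic_le_one_add_log T
  rw [harmonic_eq_sum_Icc] at h
  push_cast at h
  simpa [one_div] using h

lemma rpow_neg_quarter_pow_four_mul {T : ℕ} (hT : 1 ≤ T) :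
    ((T : ℝ) ^ (-(1 / 4) : ℝ)) ^ 4 * T = 1 := by
  have h : (0 : ℝ) < T := by exact_mod_cast hT
  rw [← Real.rpow_natCast, ← Real.rpow_mul h.le]
  norm_num
  rw [Real.rpow_neg_one, inv_mul_cancel₀ h.ne']

lemma rpow_neg_quarter_pos {T : ℕ} (hT : 1 ≤ T) : 0 < (T : ℝ) ^ (-(1 / 4) : ℝ) :=
  Real.rpow_pos_of_pos (by exact_mod_cast hT) _

lemma rpow_neg_quarter_le_one {T : ℕ} (hT : 1 ≤ T) : (T : ℝ) ^ (-(1 / 4) : ℝ) ≤ 1 :=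
  Real.rpow_le_one_of_one_le_of_nonpos (by exact_mod_cast hT) (by norm_num)

/-- The factor `√η = T^(-1/8)` beats the logarithm; `2` is the gap budget of `IsGapRun.regret_le`.
-/
lemma eventually_mul_rpow_mul_log_le (K : ℝ) : ∃ T₀ : ℕ, 1 ≤ T₀ ∧ ∀ T : ℕ, T₀ ≤ T →
    K * (((T : ℝ) ^ (-(1 / 4) : ℝ)) ^ (1 / 2 : ℝ) * (1 + Real.log T)) ≤ 2 := by
  have h1 : Filter.Tendsto (fun x : ℝ => x ^ (-(1 / 8) : ℝ)) Filter.atTop (nhds 0) :=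
    tendsto_rpow_neg_atTop (by norm_num)
  have h2 : Filter.Tendsto (fun x : ℝ => Real.log x / x ^ (1 / 8 : ℝ)) Filter.atTop (nhds 0) :=
    (isLittleO_log_rpow_atTop (by norm_num)).tendsto_div_nhds_zero
  have h3 : Filter.Tendsto (fun x : ℝ => K * (x ^ (-(1 / 8) : ℝ) + Real.log x / x ^ (1 / 8 : ℝ)))
      Filter.atTop (nhds 0) := by
    simpa using (h1.add h2).const_mul K
  have h4 := (h3.comp tendsto_natCast_atTop_atTop).eventually_le_const (by norm_num : (0 : ℝ) < 2)
  obtain ⟨T₀, hT₀⟩ := Filter.eventually_atTop.1 h4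
  refine ⟨max T₀ 1, le_max_right _ _, fun T hT => ?_⟩
  have h := hT₀ T ((le_max_left _ _).trans hT)
  have hT1 : (0 : ℝ) ≤ T := Nat.cast_nonneg T
  have e : ((T : ℝ) ^ (-(1 / 4) : ℝ)) ^ (1 / 2 : ℝ) = (T : ℝ) ^ (-(1 / 8) : ℝ) := by
    rw [← Real.rpow_mul hT1]; norm_num
  have e2 : (T : ℝ) ^ (-(1 / 8) : ℝ) = ((T : ℝ) ^ (1 / 8 : ℝ))⁻¹ := Real.rpow_neg hT1 _
  simp only [Function.comp_apply] at h
  rw [e, mul_add, mul_one]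
  have e3 : Real.log T / (T : ℝ) ^ (1 / 8 : ℝ) = (T : ℝ) ^ (-(1 / 8) : ℝ) * Real.log T := by
    rw [e2, div_eq_mul_inv, mul_comm]
  rwa [e3] at h

lemma mul_rpow_quarter_le {C ε : ℝ} {T : ℕ} (hC : 0 < C) (hε : 0 < ε)
    (h : C ^ (4 / 3 : ℝ) * ε ^ (-(4 / 3) : ℝ) ≤ T) :
    0 < T ∧ C * (T : ℝ) ^ (1 / 4 : ℝ) ≤ T * ε := by
  have hpos : 0 < C ^ (4 / 3 : ℝ) * ε ^ (-(4 / 3) : ℝ) := by positivity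
  have hT : (0 : ℝ) < T := hpos.trans_le h
  refine ⟨by exact_mod_cast hT, ?_⟩
  have e : C ^ (4 / 3 : ℝ) * ε ^ (-(4 / 3) : ℝ) = (C / ε) ^ (4 / 3 : ℝ) := by
    rw [Real.div_rpow hC.le hε.le, Real.rpow_neg hε.le, ← div_eq_mul_inv]
  rw [e] at h
  have h1 := Real.rpow_le_rpow (by positivity) h (by norm_num : (0 : ℝ) ≤ 3 / 4)
  rw [← Real.rpow_mul (by positivity)] at h1
  norm_num at h1
  rw [div_le_iff₀ hε] at h1
  calc C * (T : ℝ) ^ (1 / 4 : ℝ) ≤ ((T : ℝ) ^ (3 / 4 : ℝ) * ε) * (T : ℝ) ^ (1 / 4 : ℝ) := by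
        gcongr
    _ = ((T : ℝ) ^ (3 / 4 : ℝ) * (T : ℝ) ^ (1 / 4 : ℝ)) * ε := by ring
    _ = T * ε := by
        rw [← Real.rpow_add hT]; norm_num

/-- The logarithmic factor of away-step Frank-Wolfe for polynomially small tolerances. -/
lemma primal_le_mul_exp {L D C Z e : ℝ} (hL : 1 ≤ L) (hD : 0 < D) (hC : 1 ≤ C) (hZ : 1 ≤ Z)
    (he : 1 / (8 * C ^ 3 * Z ^ 6) ≤ e)
    (hM : (3 + L * D) * D * (64 * C ^ 6 * max (2 * L * D ^ 2) 2) ≤ Z) :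
    (3 + L * D) * D ≤ min (e ^ 2 / (2 * L * D ^ 2)) (e / 2) * Real.exp (13 * Real.log Z) := by
  have hL0 : 0 < L := by linarith
  have hC0 : 0 < C := by linarith
  have hZ0 : 0 < Z := by linarith
  set b := 1 / (8 * C ^ 3 * Z ^ 6) with hb
  have hb0 : 0 < b := by positivity
  have hb1 : b ≤ 1 := by
    rw [hb, div_le_one (by positivity)]
    have h1 : 1 ≤ C ^ 3 := one_le_pow₀ hC
    have h2 : 1 ≤ Z ^ 6 := one_le_pow₀ hZ
    nlinarith
  set K := max (2 * L * D ^ 2) 2 with hK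
  have hK0 : 0 < K := lt_max_of_lt_right two_pos
  -- The squared tolerance costs `Z ^ 12`; the thirteenth factor absorbs the constants of the game
  -- through `hM`.
  have hexp : Real.exp (13 * Real.log Z) = Z ^ 13 := by
    rw [show (13 : ℝ) = ((13 : ℕ) : ℝ) by norm_num, Real.exp_nat_mul, Real.exp_log hZ0]
  have hmin : b ^ 2 / K ≤ min (e ^ 2 / (2 * L * D ^ 2)) (e / 2) := by
    refine le_min ?_ ?_
    · have : 2 * L * D ^ 2 ≤ K := le_max_left _ _
      gcongr
    · have h1 : 2 ≤ K := le_max_right _ _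
      have h2 : b ^ 2 ≤ e := by nlinarith
      have h3 : 0 ≤ e := hb0.le.trans he
      gcongr
  rw [hexp]
  refine le_trans ?_ (mul_le_mul_of_nonneg_right hmin (by positivity))
  have e1 : b ^ 2 / K * Z ^ 13 = Z / (64 * C ^ 6 * K) := by
    rw [hb]; field_simp; norm_num
  rw [e1, le_div_iff₀ (by positivity)]
  exact hM

/-- Used with `a = L D` and `Z = 1/ε'`: even a small `L D` costs only a factor `2` once `ε'` is
small. -/
lemma log_le_two_mul_log {a Z : ℝ} (ha : 0 < a) (hZ : 1 ≤ Z) (haZ : 1 / a ^ 2 ≤ Z) :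
    Real.log Z ≤ 2 * Real.log (a * Z) := by
  have hZ0 : 0 < Z := by linarith
  rw [show (2 : ℝ) * Real.log (a * Z) = Real.log ((a * Z) ^ 2) by rw [Real.log_pow]; norm_num]
  refine Real.log_le_log hZ0 ?_
  rw [div_le_iff₀ (by positivity)] at haZ
  nlinarith

end Numerics

/-! ### The step size `T^(-1/4)` and the tolerances. -/

namespace Game

variable {N : ℕ} {G : Game N} {R : ∀ i, Regularizer (G.X i)} {ε : Fin N → ℕ → ℝ}
  {O : G.Oracles} {T : ℕ} {x : ℕ → G.Profile}

/-- Since `η⁴ T = 1`, the prediction errors cost at most `½ + 2N² + (9/2)N²`; the player's own gaps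
cost `2`. -/
lemma IsGapRun.regret_le (hG : G.Normalized) (hT : 1 ≤ T) {w : ℝ}
    (hw : ∀ i, (R i).omega ≤ w) {g : Fin N → ℕ → ℝ}
    (h : G.IsGapRun R ((T : ℝ) ^ (-(1 / 4) : ℝ)) g T x)
    (hg : ∀ i, ∑ t ∈ Finset.Icc 1 T, g i t ≤ 2) (i : Fin N) :
    G.regret x i T ≤ (w + 3 + 2 * Real.sqrt (2 * w) + 7 * (N : ℝ) ^ 2) * (T : ℝ) ^ (1 / 4 : ℝ) := by
  have hη := rpow_neg_quarter_pos hT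
  have hη1 := rpow_neg_quarter_le_one hT
  have hη4 := rpow_neg_quarter_pow_four_mul hT
  have hm := h.mul_regret_le hG hη hw i
  have hinv : (T : ℝ) ^ (1 / 4 : ℝ) = ((T : ℝ) ^ (-(1 / 4) : ℝ))⁻¹ := by
    rw [Real.rpow_neg (Nat.cast_nonneg T), inv_inv]
  rw [hinv]
  set η := (T : ℝ) ^ (-(1 / 4) : ℝ)
  rw [← div_eq_mul_inv, le_div_iff₀' hη]
  have hS : ∑ j, ∑ t ∈ Finset.Icc 1 T, g j t ≤ N * 2 := by
    have := Finset.sum_le_sum fun j (_ : j ∈ Finset.univ) => hg j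
    simpa using this
  have hN : (0 : ℝ) ≤ N := Nat.cast_nonneg N
  have hη2 : η ^ 2 ≤ 1 := pow_le_one₀ hη.le hη1
  have h1 : 2 * η * Real.sqrt (2 * w) ≤ 2 * Real.sqrt (2 * w) := by
    nlinarith [Real.sqrt_nonneg (2 * w)]
  have h2 : η ^ 2 / 2 * (1 + N * (2 * ∑ j, ∑ t ∈ Finset.Icc 1 T, g j t + 9 * N * η ^ 2 * T))
      = η ^ 2 / 2 + η ^ 2 * (N * ∑ j, ∑ t ∈ Finset.Icc 1 T, g j t)
        + 9 / 2 * (N : ℝ) ^ 2 * (η ^ 4 * T) := by ring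
  have h3 : η ^ 2 * (N * ∑ j, ∑ t ∈ Finset.Icc 1 T, g j t) ≤ 1 * (N * (N * 2)) := by
    have h0 : 0 ≤ (N : ℝ) * (N * 2) := by positivity
    calc η ^ 2 * ((N : ℝ) * ∑ j, ∑ t ∈ Finset.Icc 1 T, g j t) ≤ η ^ 2 * ((N : ℝ) * (N * 2)) := by gcongr
      _ ≤ 1 * ((N : ℝ) * (N * 2)) := by gcongr
  rw [h2, hη4] at hm
  nlinarith [hg i]

/-- Approximate proximal steps have summably small Frank-Wolfe gaps. -/
lemma IsROMDRun.isGapRun {η : ℝ} (hη : 0 < η) (hη1 : η ≤ 1)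
    (hε : ∀ i, ∀ t ∈ Finset.Icc 1 T, ε i t ≤ η * (1 / (t : ℝ) ^ 2))
    (h : G.IsROMDRun R η ε T x) :
    G.IsGapRun R η (fun i t => η ^ (1 / 2 : ℝ) * (1 / (t : ℝ))
      * (1 + |(R i).L| / 2 * Metric.diam (G.X i) ^ 2)) T x := by
  refine ⟨fun t ht i => ?_, fun t ht i u hu => ?_⟩
  · rcases Nat.eq_zero_or_pos t with rfl | ht0
    · exact h.1 i
    · exact (h.2 t (Finset.mem_Icc.2 ⟨ht0, ht⟩) i).1
  · have ht1 : (1 : ℝ) ≤ t := by exact_mod_cast (Finset.mem_Icc.1 ht).1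
    have ht0 : (0 : ℝ) < t := by linarith
    have hs0 : 0 < η ^ (1 / 2 : ℝ) := Real.rpow_pos_of_pos hη _
    have hs1 : η ^ (1 / 2 : ℝ) ≤ 1 := Real.rpow_le_one hη.le hη1 (by norm_num)
    have hss : η ^ (1 / 2 : ℝ) * η ^ (1 / 2 : ℝ) = η := by
      rw [← Real.rpow_add hη]; norm_num
    set s := η ^ (1 / 2 : ℝ)
    -- The choice `γ = √η/t` makes `ε/γ ≤ γ`, so both terms of the gap bound are multiples of `γ`.
    have hγ0 : 0 < s * (1 / (t : ℝ)) := by positivity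
    have hγ1 : s * (1 / (t : ℝ)) ≤ 1 := by
      have : 1 / (t : ℝ) ≤ 1 := by rw [div_le_one ht0]; exact ht1
      exact mul_le_one₀ hs1 (by positivity) this
    refine ((R i).gap_le_of_isAPO (D := Metric.diam (G.X i)) hγ0 hγ1 (fun a ha b hb => ?_) (h.2 t ht i) hu).trans ?_
    · rw [← dist_eq_norm]
      exact Metric.dist_le_diam_of_mem (G.isCompact_X i).isBounded ha hb
    · have h1 : ε i t / (s * (1 / (t : ℝ))) ≤ s * (1 / (t : ℝ)) := by
        rw [div_le_iff₀ hγ0]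
        refine (hε i t ht).trans_eq ?_
        rw [← hss]; ring
      linarith

lemma regret_zero (x : ℕ → G.Profile) (i : Fin N) : G.regret x i 0 = 0 := by
  simp [regret, (G.X_nonempty i).image_const]

/-- The crude bound `T^(-1/4)/t² ≥ T^(-3)` suffices: tolerances enter the count only through a
logarithm. -/
lemma tolerance_lower_bound {t : ℕ} (ht : t ∈ Finset.Icc 1 T) {C Z e : ℝ}
    (hT : (T : ℝ) ≤ 2 * C * Z ^ 2)
    (he : (T : ℝ) ^ (-(1 / 4) : ℝ) * (1 / (t : ℝ) ^ 2) ≤ e) : 1 / (8 * C ^ 3 * Z ^ 6) ≤ e := by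
  obtain ⟨h1, h2⟩ := Finset.mem_Icc.1 ht
  have ht0 : (0 : ℝ) < t := by exact_mod_cast h1
  have htT : (t : ℝ) ≤ T := by exact_mod_cast h2
  have hT1 : (1 : ℝ) ≤ T := by exact_mod_cast h1.trans h2
  have hT0 : (0 : ℝ) < T := by linarith
  refine le_trans ?_ he
  have h3 : (T : ℝ)⁻¹ ≤ (T : ℝ) ^ (-(1 / 4) : ℝ) := by
    rw [← Real.rpow_neg_one]
    exact Real.rpow_le_rpow_of_exponent_le hT1 (by norm_num)
  calc 1 / (8 * C ^ 3 * Z ^ 6) = 1 / (2 * C * Z ^ 2) ^ 3 := by ring_nf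
    _ ≤ 1 / (T : ℝ) ^ 3 := by gcongr
    _ = (T : ℝ)⁻¹ * (1 / (T : ℝ) ^ 2) := by field_simp
    _ ≤ _ := by gcongr

/-- Calls of player `i` in one round, in terms of the target accuracy `ε'`. -/
lemma callsAt_le_log (hG : G.Normalized) (hT : 1 ≤ T) {i : Fin N} (hV : 1 < (G.V i).card)
    (hx : ∀ t ≤ T, ∀ i, x t i ∈ G.X i) {t : ℕ} (ht : t ∈ Finset.Icc 1 T) {C ε' : ℝ} (hC : 1 ≤ C)
    (hε' : 0 < ε') (hZ : 3 ≤ 1 / ε') (hTZ : (T : ℝ) ≤ 2 * C * (1 / ε') ^ 2)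
    (he : (T : ℝ) ^ (-(1 / 4) : ℝ) * (1 / (t : ℝ) ^ 2) ≤ ε i t)
    (hM : (3 + (R i).L * Metric.diam (G.X i)) * Metric.diam (G.X i)
      * (64 * C ^ 6 * max (2 * (R i).L * Metric.diam (G.X i) ^ 2) 2) ≤ 1 / ε')
    (hLD : 1 / ((R i).L * Metric.diam (G.X i)) ^ 2 ≤ 1 / ε') :
    0 ≤ (R i).L * Metric.diam (G.X i) ^ 2 / facialDistance (G.V i) ^ 2
        * Real.log ((R i).L * Metric.diam (G.X i) / ε') ∧
    (G.callsAt R ((T : ℝ) ^ (-(1 / 4) : ℝ)) ε O x i t : ℝ) ≤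
      214 * ((R i).L * Metric.diam (G.X i) ^ 2 / facialDistance (G.V i) ^ 2
        * Real.log ((R i).L * Metric.diam (G.X i) / ε')) := by
  have hL := one_le_L R hV
  have hδ := facialDistance_pos hV
  have hδD : facialDistance (G.V i) ≤ Metric.diam (G.X i) := facialDistance_le_diam hV
  have hD : 0 < Metric.diam (G.X i) := hδ.trans_le hδD
  have hlow := tolerance_lower_bound ht hTZ he
  have hmain := primal_le_mul_exp hL hD hC (by linarith) hlow hM
  have hlog0 : 1 ≤ Real.log (1 / ε') := by
    rw [Real.le_log_iff_exp_le (by linarith)]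
    linarith [Real.exp_one_lt_d9]
  have hlog := log_le_two_mul_log (by positivity) (by linarith) hLD
  rw [mul_one_div] at hlog
  have hcalls := callsAt_le (R := R) (O := O) (ε := ε) hG (rpow_neg_quarter_pos hT).le
    (rpow_neg_quarter_le_one hT) hV (Finset.mem_Icc.1 ht).1
    (fun s hs j => hx s (hs.le.trans (Finset.mem_Icc.1 ht).2) j)
    (lt_of_lt_of_le (by positivity) hlow) (by linarith) hmain
  have hA : 1 ≤ (R i).L * Metric.diam (G.X i) ^ 2 / facialDistance (G.V i) ^ 2 := by
    rw [one_le_div (by positivity)]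
    have : facialDistance (G.V i) ^ 2 ≤ Metric.diam (G.X i) ^ 2 := by gcongr
    nlinarith [sq_nonneg (Metric.diam (G.X i))]
  set A := (R i).L * Metric.diam (G.X i) ^ 2 / facialDistance (G.V i) ^ 2
  set l := Real.log ((R i).L * Metric.diam (G.X i) / ε')
  refine ⟨by nlinarith, hcalls.trans ?_⟩
  -- Here `214 = 8 * 26 + 6`, where `3 ≤ 6 A l` because `A ≥ 1` and `l ≥ 1/2`.
  have h1 : A * (13 * Real.log (1 / ε')) ≤ A * (26 * l) :=
    mul_le_mul_of_nonneg_left (by linarith) (by linarith)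
  nlinarith

end Game

end PolyGame

/-! ### Total LMO count and the threshold horizon. -/

namespace PolyGame.Game

variable {N : ℕ} {G : Game N} {R : ∀ i, Regularizer (G.X i)} {ε : Fin N → ℕ → ℝ}
  {O : G.Oracles} {T : ℕ} {x : ℕ → G.Profile}

/-- Total number of LMO calls, in terms of the target accuracy `ε'`. -/
lemma sum_callsAt_le (hG : G.Normalized) (hV : ∀ i, 1 < (G.V i).card) {C ε' : ℝ} (hC : 1 ≤ C)
    (hx : ∀ t ≤ T, ∀ i, x t i ∈ G.X i) (hε' : 0 < ε') (hZ : 3 ≤ 1 / ε')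
    (hT : T = ⌈C * ε' ^ (-(4 / 3) : ℝ)⌉₊)
    (he : ∀ i, ∀ t ∈ Finset.Icc 1 T, (T : ℝ) ^ (-(1 / 4) : ℝ) * (1 / (t : ℝ) ^ 2) ≤ ε i t)
    (hM : ∀ i, (3 + (R i).L * Metric.diam (G.X i)) * Metric.diam (G.X i)
      * (64 * C ^ 6 * max (2 * (R i).L * Metric.diam (G.X i) ^ 2) 2) ≤ 1 / ε')
    (hLD : ∀ i, 1 / ((R i).L * Metric.diam (G.X i)) ^ 2 ≤ 1 / ε') :
    ((∑ i, ∑ t ∈ Finset.Icc 1 T, G.callsAt R ((T : ℝ) ^ (-(1 / 4) : ℝ)) ε O x i t : ℕ) : ℝ) ≤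
      (428 * C * N + 1) * ⨆ i, ε' ^ (-(4 / 3) : ℝ) *
        ((R i).L * Metric.diam (G.X i) ^ 2 / facialDistance (G.V i) ^ 2) *
        Real.log ((R i).L * Metric.diam (G.X i) / ε') := by
  have hZ0 : 0 < 1 / ε' := by linarith
  set E := ε' ^ (-(4 / 3) : ℝ) with hE
  have hEe : E = (1 / ε') ^ (4 / 3 : ℝ) := by
    rw [hE, Real.rpow_neg hε'.le, one_div, Real.inv_rpow hε'.le]
  have hE1 : 1 ≤ E := by
    rw [hEe]; exact Real.one_le_rpow (by linarith) (by norm_num)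
  have hE2 : E ≤ (1 / ε') ^ 2 := by
    rw [hEe, ← Real.rpow_natCast]
    exact Real.rpow_le_rpow_of_exponent_le (by linarith) (by norm_num)
  have hCE : 1 ≤ C * E := by nlinarith
  -- Rounding up costs at most a factor `2` as `C * E ≥ 1`; hence `428 = 2 * 214`.
  have hTE : (T : ℝ) ≤ 2 * C * E := by
    have := Nat.ceil_lt_add_one (by linarith : 0 ≤ C * E)
    rw [← hT] at this
    linarith
  have hT1 : 1 ≤ T := by
    rw [hT]; exact Nat.one_le_ceil_iff.2 (by linarith)
  have hTZ : (T : ℝ) ≤ 2 * C * (1 / ε') ^ 2 := hTE.trans (by gcongr)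
  set F : Fin N → ℝ := fun i => E *
    ((R i).L * Metric.diam (G.X i) ^ 2 / facialDistance (G.V i) ^ 2) *
    Real.log ((R i).L * Metric.diam (G.X i) / ε') with hF
  have h1m : 1 ∈ Finset.Icc 1 T := Finset.mem_Icc.2 ⟨le_rfl, hT1⟩
  have hcall := fun i t (ht : t ∈ Finset.Icc 1 T) => callsAt_le_log (R := R) (O := O) hG hT1 (hV i)
    hx ht hC hε' hZ hTZ (he i t ht) (hM i) (hLD i)
  have hF0 : ∀ i, 0 ≤ F i := fun i => by
    have := mul_nonneg (by linarith : 0 ≤ E) (hcall i 1 h1m).1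
    rw [← mul_assoc] at this
    exact this
  have hplayer : ∀ i, ∑ t ∈ Finset.Icc 1 T,
      (G.callsAt R ((T : ℝ) ^ (-(1 / 4) : ℝ)) ε O x i t : ℝ) ≤ 428 * C * F i := by
    intro i
    obtain ⟨hnn, -⟩ := hcall i 1 h1m
    refine (Finset.sum_le_sum fun t ht => (hcall i t ht).2).trans ?_
    rw [Finset.sum_const, Nat.card_Icc, Nat.add_sub_cancel, nsmul_eq_mul]
    refine (mul_le_mul_of_nonneg_right hTE (mul_nonneg (by norm_num) hnn)).trans_eq ?_
    simp only [hF]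
    ring
  have hsup : ∀ i, F i ≤ ⨆ i, F i := fun i => le_ciSup (Set.finite_range F).bddAbove i
  have hsup0 : 0 ≤ ⨆ i, F i := Real.iSup_nonneg hF0
  push_cast
  calc ∑ i, ∑ t ∈ Finset.Icc 1 T, (G.callsAt R ((T : ℝ) ^ (-(1 / 4) : ℝ)) ε O x i t : ℝ)
      ≤ ∑ _i : Fin N, 428 * C * ⨆ i, F i := Finset.sum_le_sum fun i _ =>
        (hplayer i).trans (mul_le_mul_of_nonneg_left (hsup i) (by linarith))
    _ = 428 * C * N * ⨆ i, F i := by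
        rw [Finset.sum_const, Finset.card_univ, Fintype.card_fin, nsmul_eq_mul]; ring
    _ ≤ (428 * C * N + 1) * ⨆ i, F i := by
        gcongr
        linarith

/-- For long horizons the Frank-Wolfe gaps of approximate proximal steps have a small sum. -/
lemma exists_sum_gap_le_two (R : ∀ i, Regularizer (G.X i)) : ∃ T₀ : ℕ, 1 ≤ T₀ ∧
    ∀ T : ℕ, T₀ ≤ T → ∀ i, ∑ t ∈ Finset.Icc 1 T,
      ((T : ℝ) ^ (-(1 / 4) : ℝ)) ^ (1 / 2 : ℝ) * (1 / (t : ℝ))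
        * (1 + |(R i).L| / 2 * Metric.diam (G.X i) ^ 2) ≤ 2 := by
  obtain ⟨T₀, h1, hT₀⟩ := eventually_mul_rpow_mul_log_le
    (∑ i, (1 + |(R i).L| / 2 * Metric.diam (G.X i) ^ 2))
  refine ⟨T₀, h1, fun T hT i => (le_trans ?_ (hT₀ T hT))⟩
  have hT1 : (1 : ℝ) ≤ T := by exact_mod_cast h1.trans hT
  rw [← Finset.sum_mul, ← Finset.mul_sum, mul_comm]
  have hk : ∀ j, 0 ≤ 1 + |(R j).L| / 2 * Metric.diam (G.X j) ^ 2 := fun j => by positivity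
  have hs : 0 ≤ ((T : ℝ) ^ (-(1 / 4) : ℝ)) ^ (1 / 2 : ℝ) := by positivity
  have hl : 0 ≤ 1 + Real.log T := by linarith [Real.log_nonneg hT1]
  refine mul_le_mul (Finset.single_le_sum (fun j _ => hk j) (Finset.mem_univ i)) ?_
    (mul_nonneg hs (Finset.sum_nonneg fun t _ => by positivity))
    (Finset.sum_nonneg fun j _ => hk j)
  exact mul_le_mul_of_nonneg_left (sum_Icc_one_div_le_one_add_log T) hs

end PolyGame.Game

/-! ### Choice of the constants and conclusion. -/

open PolyGame PolyGame.Game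

theorem mainTheorem5 (N : ℕ) (ω : ℝ) :
    -- the constants depend only on the number of players and on the bound `ω` on the `Ω_i`
    ∃ C₁ C₂ C₃ : ℝ, 0 < C₁ ∧ 0 < C₂ ∧ 0 < C₃ ∧
    ∀ (G : PolyGame.Game N), G.Normalized →
    ∀ R : ∀ i, PolyGame.Regularizer (G.X i), (∀ i, (R i).omega ≤ ω) →
    ∃ (T₀ : ℕ) (ε₀ : ℝ), 0 < ε₀ ∧
      -- approximate reflected online mirror descent with arbitrary approximate proximal oracles
      (∀ (T : ℕ) (ε : Fin N → ℕ → ℝ) (x : ℕ → G.Profile),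
        (∀ i, ∀ t ∈ Finset.Icc 1 T,
          0 ≤ ε i t ∧ ε i t ≤ (T : ℝ) ^ (-(1 / 4) : ℝ) * (1 / (t : ℝ) ^ 2)) →
        G.IsROMDRun R ((T : ℝ) ^ (-(1 / 4) : ℝ)) ε T x →
        (T₀ ≤ T → ∀ i, G.regret x i T ≤ C₁ * (T : ℝ) ^ (1 / 4 : ℝ)) ∧
        (∀ ε' : ℝ, 0 < ε' → ε' ≤ ε₀ → C₂ * ε' ^ (-(4 / 3) : ℝ) ≤ (T : ℝ) →
          ∀ w, G.Represents T x w → G.IsCCE (G.avgJoint T w) ε')) ∧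
      -- AFW-ROMD
      (∀ (T : ℕ) (ε : Fin N → ℕ → ℝ) (O : G.Oracles) (x : ℕ → G.Profile),
        (∀ i, ∀ t ∈ Finset.Icc 1 T,
          (T : ℝ) ^ (-(1 / 4) : ℝ) * (1 / (t : ℝ) ^ 2) ≤ ε i t ∧ ε i t ≤ 1 / (t : ℝ) ^ 2) →
        G.IsAFWRun R ((T : ℝ) ^ (-(1 / 4) : ℝ)) ε O T x →
        (∀ i, ∀ t ∈ Finset.Icc 1 T, G.HaltsAt R ((T : ℝ) ^ (-(1 / 4) : ℝ)) ε O x i t) ∧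
        (∀ i, G.regret x i T ≤ C₁ * (T : ℝ) ^ (1 / 4 : ℝ)) ∧
        (∀ ε' : ℝ, 0 < ε' → C₂ * ε' ^ (-(4 / 3) : ℝ) ≤ (T : ℝ) →
          ∀ w, G.Represents T x w → G.IsCCE (G.avgJoint T w) ε') ∧
        (∀ ε' : ℝ, 0 < ε' → ε' ≤ ε₀ → (∀ i, 1 < (G.V i).card) →
          T = ⌈C₂ * ε' ^ (-(4 / 3) : ℝ)⌉₊ →
          ((∑ i, ∑ t ∈ Finset.Icc 1 T,
              G.callsAt R ((T : ℝ) ^ (-(1 / 4) : ℝ)) ε O x i t : ℕ) : ℝ) ≤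
            C₃ * ⨆ i, ε' ^ (-(4 / 3) : ℝ) *
              ((R i).L * Metric.diam (G.X i) ^ 2 / PolyGame.facialDistance (G.V i) ^ 2) *
              Real.log ((R i).L * Metric.diam (G.X i) / ε'))) := by
  -- For `N = 0` the hypothesis does not control the sign of `ω`.
  set w := max ω 0
  set C₁ : ℝ := w + 3 + 2 * Real.sqrt (2 * w) + 7 * (N : ℝ) ^ 2 with hC₁
  have hw0 : 0 ≤ w := le_max_right _ _
  have hC₁1 : 1 ≤ C₁ := by
    have := Real.sqrt_nonneg (2 * w)
    have : 0 ≤ 7 * (N : ℝ) ^ 2 := by positivity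
    linarith
  have hC₁0 : 0 < C₁ := by linarith
  set C₂ : ℝ := C₁ ^ (4 / 3 : ℝ) with hC₂
  have hC₂1 : 1 ≤ C₂ := Real.one_le_rpow hC₁1 (by norm_num)
  have hC₂0 : 0 < C₂ := by linarith
  -- The `+ 1` keeps the third constant positive when `N = 0`.
  refine ⟨C₁, C₂, 428 * C₂ * N + 1, hC₁0, hC₂0, by positivity, fun G hG R hR => ?_⟩
  have hRw : ∀ i, (R i).omega ≤ w := fun i => (hR i).trans (le_max_left _ _)
  obtain ⟨T₀, hT₀1, hT₀⟩ := exists_sum_gap_le_two R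
  -- `1/ε' ≥ Z₀` dominates every game-dependent quantity in the count, and `3 > e` makes `log (1/ε')
  -- ≥ 1`.
  set Z₀ : ℝ := 3 + ∑ i, (|(3 + (R i).L * Metric.diam (G.X i)) * Metric.diam (G.X i)
      * (64 * C₂ ^ 6 * max (2 * (R i).L * Metric.diam (G.X i) ^ 2) 2)|
      + 1 / ((R i).L * Metric.diam (G.X i)) ^ 2) with hZ₀
  have hterm : ∀ i, 0 ≤ |(3 + (R i).L * Metric.diam (G.X i)) * Metric.diam (G.X i)
      * (64 * C₂ ^ 6 * max (2 * (R i).L * Metric.diam (G.X i) ^ 2) 2)|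
      + 1 / ((R i).L * Metric.diam (G.X i)) ^ 2 := fun i => by positivity
  have hZ₀3 : 3 ≤ Z₀ := by
    have := Finset.sum_nonneg fun i (_ : i ∈ Finset.univ) => hterm i
    linarith
  have hZ₀i : ∀ i, |(3 + (R i).L * Metric.diam (G.X i)) * Metric.diam (G.X i)
      * (64 * C₂ ^ 6 * max (2 * (R i).L * Metric.diam (G.X i) ^ 2) 2)|
      + 1 / ((R i).L * Metric.diam (G.X i)) ^ 2 ≤ Z₀ := fun i => by
    have := Finset.single_le_sum (fun i _ => hterm i) (Finset.mem_univ i)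
    linarith
  have hT₀0 : (0 : ℝ) < T₀ := by exact_mod_cast hT₀1
  -- The bound `ε' ≤ T₀^(-3/4)` ensures `T ≥ ε'^(-4/3) ≥ T₀`, since `C₂ ≥ 1`.
  refine ⟨T₀, min (1 / Z₀) ((T₀ : ℝ) ^ (-(3 / 4) : ℝ)), lt_min (by positivity)
    (Real.rpow_pos_of_pos hT₀0 _), fun T ε x hε hrun => ?_, fun T ε O x hε hrun => ?_⟩
  · have hreg : T₀ ≤ T → ∀ i, G.regret x i T ≤ C₁ * (T : ℝ) ^ (1 / 4 : ℝ) := fun hT i => by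
      have hT1 := hT₀1.trans hT
      exact (hrun.isGapRun (rpow_neg_quarter_pos hT1) (rpow_neg_quarter_le_one hT1)
        fun i t ht => (hε i t ht).2).regret_le hG hT1 hRw (hT₀ T hT) i
    refine ⟨hreg, fun ε' hε' hε'0 hT v hv => ?_⟩
    obtain ⟨hTpos, hTε⟩ := mul_rpow_quarter_le hC₁0 hε' hT
    have hTT : T₀ ≤ T := by
      have h1 : (T₀ : ℝ) ≤ ε' ^ (-(4 / 3) : ℝ) := by
        have h := Real.rpow_le_rpow_of_nonpos hε' (hε'0.trans (min_le_right _ _))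
          (by norm_num : (-(4 / 3) : ℝ) ≤ 0)
        rw [← Real.rpow_mul hT₀0.le] at h
        norm_num at h ⊢
        exact h
      have h2 : (T₀ : ℝ) ≤ T := by
        refine le_trans ?_ hT
        nlinarith
      exact_mod_cast h2
    exact isCCE_avgJoint hTpos hv fun i => (hreg hTT i).trans hTε
  · have hpos : ∀ i, ∀ t ∈ Finset.Icc 1 T, 0 < ε i t := fun i t ht => by
      obtain ⟨h1, h2⟩ := Finset.mem_Icc.1 ht
      have ht0 : (0 : ℝ) < t := by exact_mod_cast h1
      exact lt_of_lt_of_le (mul_pos (rpow_neg_quarter_pos (h1.trans h2)) (by positivity))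
        (hε i t ht).1
    have hgap := hrun.isGapRun hpos
    have hreg : ∀ i, G.regret x i T ≤ C₁ * (T : ℝ) ^ (1 / 4 : ℝ) := fun i => by
      rcases Nat.eq_zero_or_pos T with rfl | hT
      · rw [regret_zero]; positivity
      · exact hgap.regret_le hG hT hRw (fun i => (Finset.sum_le_sum fun t ht =>
          (hε i t ht).2).trans (sum_Icc_one_div_sq_le_two T)) i
    refine ⟨fun i t ht => haltsAt hpos i ht, hreg, fun ε' hε' hT v hv => ?_,
      fun ε' hε' hε'0 hV hT => ?_⟩
    · obtain ⟨hTpos, hTε⟩ := mul_rpow_quarter_le hC₁0 hε' hT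
      exact isCCE_avgJoint hTpos hv fun i => (hreg i).trans hTε
    · have hZ : Z₀ ≤ 1 / ε' := by
        rw [le_div_iff₀ hε', ← le_div_iff₀' (by linarith)]
        exact hε'0.trans (min_le_left _ _)
      refine sum_callsAt_le hG hV hC₂1 hgap.1 hε' (hZ₀3.trans hZ) hT
        (fun i t ht => (hε i t ht).1) (fun i => ?_) (fun i => ?_)
      · refine le_trans ?_ ((hZ₀i i).trans hZ)
        exact (le_abs_self _).trans (le_add_of_nonneg_right (by positivity))
      · refine le_trans ?_ ((hZ₀i i).trans hZ)
        exact le_add_of_nonneg_left (abs_nonneg _)
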